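/- Let $n\ge r\ge 1$ be integers such that $n=q_1r+r_1$ with $0<r_1<r$ and $r=q_2r_1+r_2$ with $0\le r_2<r_1$ (the first two steps of the Euclidean algorithm). **Jacobian extensions.** Let $\mathcal A$ be the ring of germs at $0$ of holomorphic functions on $\mathbb C^m$ with coordinates $x_1,\dots,x_m$. For an ideal $J\subseteq\mathcal A$, let $\Delta_kJ$ be the ideal generated by $J$ and all $k\times k$ minors of the Jacobian matrix $(\partial f/\partial x_j)_{f\in J,\,1\le j\le m}$ (so $\Delta_0J=\mathcal A$ and $\Delta_{m+1}J=J$), and put $\Delta^iJ=\Delta_{m-i+1}J$. The critical extension of a proper ideal $J$ is $\Delta^iJ=\Delta_kJ$, where $k=m-i+1$ is the least order with $\Delta_kJ\ne\mathcal A$. The Thom–Boardman symbol $TB(J)=(i_1,i_2,\dots)$ is the sequence of upper indices of the successive critical extensions $J\subseteq\Delta^{i_1}J\subseteq\Delta^{i_2}\Delta^{i_1}J\subseteq\cdots$; it is regarded as an infinite sequence, whose entries are $0$ once the maximal ideal is reached. **The multiplication map.** Let $f(x)=x^n+a_{n-1}x^{n-1}+\dots+a_0$, $g(x)=x^r+b_{r-1}x^{r-1}+\dots+b_0$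 and $f(x)g(x)=x^{n+r}+c_{n+r-1}x^{n+r-1}+\dots+c_0$. Let $I(\mu_{n,r})=(c_0,\dots,c_{n+r-1})$ in the ring of holomorphic germs at the origin of $\mathbb C^n\times\mathbb C^r$ with coordinates $a_0,\dots,a_{n-1},b_0,\dots,b_{r-1}$ (so $m=n+r$). **The polynomials.** Put $A(t)=1+a_{n-1}t+\dots+a_0t^n$ and $B(t)=1+b_{r-1}t+\dots+b_0t^r$, and define polynomials $d_i,\gamma_i,\beta_i$ in the $a$'s and $b$'s by the power series expansions $$D(t)=B(t)^{-1}A(t)=1+\sum_{j\ge1}d_{n-j}t^j,\qquad B(t)^{-q_1}A(t)=1+\sum_{j\ge1}\gamma_{n-j}t^j,\qquad \bigl(B(t)^{-q_1}D(t)\bigr)^{-1}=1+\sum_{j\ge1}\beta_{n-j}t^j .$$ Let - $\psi_i=d_i$ for $0\le i<r$; - $\psi_{sr+i}=\dfrac{\partial^{s-1}}{\partial b_0^{s-1}}\dfrac{\partial d_{r-1}}{\partial b_{r-1-i}}$ for $1\le s\le q_1-1$ and $0\le i<r$; - $\psi_{q_1r+i}=\beta_{(q_1-1)r+r_1+i}$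 for $0\le i<r_1$. These are the polynomials $\psi_0,\dots,\psi_{n-1}$ attached to the pair $(n,r)$. The same construction (with quotient $q_2$ and remainder $r_2$, the last family being empty if $r_2=0$) attaches to the pair $(r,r_1)$ polynomials in the coefficients of two generic monic polynomials of degrees $r$ and $r_1$. Let $\varphi_0,\dots,\varphi_{r-1}$ be obtained from these by substituting the coefficients of $g(x)$ for those of the polynomial of degree $r$, and the coefficients of $x^{r_1}+\gamma_{n-1}x^{r_1-1}+\dots+\gamma_{n-r_1}$ for those of the polynomial of degree $r_1$. **Theorem.** For every $s=1,\dots,q_2$, $$(\Delta^{r_1})^s(\Delta^r)^{q_1}I(\mu_{n,r})=I(\mu_{n,r})+(\psi_0,\dots,\psi_{q_1r-1},\varphi_0,\dots,\varphi_{sr_1-1}),$$ and $$\Delta^{r_2}(\Delta^{r_1})^{q_2}(\Delta^r)^{q_1}I(\mu_{n,r})=I(\mu_{n,r})+(\psi_0,\dots,\psi_{q_1r-1},\varphi_0,\dots,\varphi_{q_2r_1-1},\varphi_{q_2r_1},\dots,\varphi_{q_2r_1+r_2-1}).$$ Moreover, the first $q_1+q_2+1$ entries of $TB(I(\mu_{n,r}))$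 are $(r,\dots,r,r_1,\dots,r_1,r_2)$, with $r$ repeated $q_1$ times and $r_1$ repeated $q_2$ times. -/

import Mathlib

open scoped Topology

namespace ThomBoardman

/-! ### Germs of holomorphic functions at the origin of `ℂ^σ` -/

section Germs

variable (σ : Type) [Fintype σ]

/-- The ring of germs at the origin of holomorphic functions on `ℂ^σ`. -/
def analyticGerms : Subring (Filter.Germ (𝓝 (0 : σ → ℂ)) ℂ) where
  carrier := {g | ∃ f : (σ → ℂ) → ℂ, AnalyticAt ℂ f 0 ∧ (f : Filter.Germ (𝓝 (0 : σ → ℂ)) ℂ) = g}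
  mul_mem' := by
    rintro _ _ ⟨f, hf, rfl⟩ ⟨g, hg, rfl⟩
    exact ⟨f * g, hf.mul hg, rfl⟩
  one_mem' := ⟨1, analyticAt_const, rfl⟩
  add_mem' := by
    rintro _ _ ⟨f, hf, rfl⟩ ⟨g, hg, rfl⟩
    exact ⟨f + g, hf.add hg, rfl⟩
  zero_mem' := ⟨0, analyticAt_const, rfl⟩
  neg_mem' := by
    rintro _ ⟨f, hf, rfl⟩
    exact ⟨-f, hf.neg, rfl⟩

variable {σ}

/-- The partial derivative `∂g/∂x_i` of a holomorphic germ. -/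
noncomputable def partialDeriv [DecidableEq σ] (i : σ) (g : analyticGerms σ) : analyticGerms σ :=
  ⟨Filter.Germ.map' (fun f x => fderiv ℂ f x (Pi.single i 1))
      (fun _ _ h => h.fderiv.fun_comp (fun L : (σ → ℂ) →L[ℂ] ℂ => L (Pi.single i 1))) g.1, by
    obtain ⟨_, f, hf, rfl⟩ := g
    exact ⟨fun x => fderiv ℂ f x (Pi.single i 1),
      ((ContinuousLinearMap.apply ℂ ℂ (Pi.single i (1 : ℂ) : σ → ℂ)).analyticAt _).comp
        (AnalyticAt.fderiv hf), rfl⟩⟩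

/-- The germ at the origin of a polynomial function. -/
noncomputable def polyGerm (p : MvPolynomial σ ℂ) : analyticGerms σ :=
  ⟨((fun x : σ → ℂ => MvPolynomial.eval x p) : Filter.Germ (𝓝 (0 : σ → ℂ)) ℂ), _,
    AnalyticOnNhd.eval_mvPolynomial p 0 (Set.mem_univ _), rfl⟩

/-! ### Jacobian extensions and the Thom-Boardman symbol -/

variable [DecidableEq σ]

/-- The Jacobian extension `Δ_k J`: the ideal spanned by `J` and all minors of order `k` of the
Jacobian matrix `(∂f/∂x_j)`, `f ∈ J`. (Repeated rows or columns only contribute the minor `0`; for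
`k = 0` the minor is `1`.) -/
noncomputable def jacobianExtension (k : ℕ) (J : Ideal (analyticGerms σ)) :
    Ideal (analyticGerms σ) :=
  J ⊔ Ideal.span {δ | ∃ (f : Fin k → J) (x : Fin k → σ),
    δ = (Matrix.of fun i j => partialDeriv (x j) (f i : analyticGerms σ)).det}

/-- Upper indexing: `Δ^i J = Δ_{m - i + 1} J`, with `m` the number of variables. -/
noncomputable def upperExtension (i : ℕ) (J : Ideal (analyticGerms σ)) :
    Ideal (analyticGerms σ) :=
  jacobianExtension (Fintype.card σ + 1 - i) J

/-- The upper index of the critical extension of `J`: it is `m + 1 - k`, where `k` is the least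
order for which `Δ_k J` is not the whole ring. -/
noncomputable def criticalIndex (J : Ideal (analyticGerms σ)) : ℕ :=
  Fintype.card σ + 1 - sInf {k : ℕ | jacobianExtension k J ≠ ⊤}

/-- The successive critical extensions of `J`, starting with `J` itself. -/
noncomputable def criticalChain (J : Ideal (analyticGerms σ)) : ℕ → Ideal (analyticGerms σ)
  | 0 => J
  | k + 1 => upperExtension (criticalIndex (criticalChain J k)) (criticalChain J k)

/-- The Thom-Boardman symbol of `J` as an infinite sequence: entry number `k` (counted from `0`)
is the upper index of the critical extension leading from the `k`-th ideal of the chain of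
critical extensions to the next one. -/
noncomputable def tbSymbol (J : Ideal (analyticGerms σ)) (k : ℕ) : ℕ :=
  criticalIndex (criticalChain J k)

end Germs

/-! ### The multiplication map -/

section Multiplication

/-- Polynomials in the coefficients `a_0, …, a_{n-1}` of `f` (left summand) and
`b_0, …, b_{r-1}` of `g` (right summand). -/
abbrev CoeffPoly (n r : ℕ) : Type := MvPolynomial (Fin n ⊕ Fin r) ℂ

/-- The generic monic polynomial `f(x) = x^n + a_{n-1} x^{n-1} + ⋯ + a_0`. -/
noncomputable def genericF (n r : ℕ) : Polynomial (CoeffPoly n r) :=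
  Polynomial.X ^ n +
    ∑ i : Fin n, Polynomial.C (MvPolynomial.X (Sum.inl i)) * Polynomial.X ^ (i : ℕ)

/-- The generic monic polynomial `g(x) = x^r + b_{r-1} x^{r-1} + ⋯ + b_0`. -/
noncomputable def genericG (n r : ℕ) : Polynomial (CoeffPoly n r) :=
  Polynomial.X ^ r +
    ∑ j : Fin r, Polynomial.C (MvPolynomial.X (Sum.inr j)) * Polynomial.X ^ (j : ℕ)

/-- The ideal `I(μ_{n,r})` generated by the germs of the coefficients `c_0, …, c_{n+r-1}` of
`f(x) g(x)`. -/
noncomputable def multIdeal (n r : ℕ) : Ideal (analyticGerms (Fin n ⊕ Fin r)) :=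
  Ideal.span {h | ∃ j < n + r, h = polyGerm ((genericF n r * genericG n r).coeff j)}

/-! The lower Toeplitz matrix with coefficients `v_0 = 1, v_1, v_2, …` along its diagonals is
`∑ v_j L^j` for the nilpotent lower shift `L`, and sums, products and inverses of such matrices are
those of the power series `∑ v_j t^j`, truncated. The polynomials below are read off as coefficients
of these power series. -/

/-- `A(t) = 1 + a_{n-1} t + ⋯ + a_0 t^n`. -/
noncomputable def seriesA (n r : ℕ) : PowerSeries (CoeffPoly n r) :=
  1 + ∑ i : Fin n, PowerSeries.C (MvPolynomial.X (Sum.inl i)) * PowerSeries.X ^ (n - (i : ℕ))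

/-- `B(t) = 1 + b_{r-1} t + ⋯ + b_0 t^r`. -/
noncomputable def seriesB (n r : ℕ) : PowerSeries (CoeffPoly n r) :=
  1 + ∑ j : Fin r, PowerSeries.C (MvPolynomial.X (Sum.inr j)) * PowerSeries.X ^ (r - (j : ℕ))

/-- `B(t)⁻¹`. -/
noncomputable def invB (n r : ℕ) : PowerSeries (CoeffPoly n r) :=
  PowerSeries.invOfUnit (seriesB n r) 1

/-- `D(t) = B(t)⁻¹ A(t) = 1 + d_{n-1} t + ⋯ + d_0 t^n + ⋯`. -/
noncomputable def seriesD (n r : ℕ) : PowerSeries (CoeffPoly n r) :=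
  invB n r * seriesA n r

/-- The polynomial `d_i`, for `i ≤ n`. -/
noncomputable def dPoly (n r i : ℕ) : CoeffPoly n r :=
  PowerSeries.coeff (n - i) (seriesD n r)

/-- The polynomial `γ_i`, for `i ≤ n`: `B(t)^{-q} A(t) = 1 + γ_{n-1} t + γ_{n-2} t^2 + ⋯`, where `q`
is the quotient of `n` by `r`. -/
noncomputable def gammaPoly (n r i : ℕ) : CoeffPoly n r :=
  PowerSeries.coeff (n - i) (invB n r ^ (n / r) * seriesA n r)

/-- The polynomial `β_i`, for `i ≤ n`: `(B(t)^{-q} D(t))⁻¹ = 1 + β_{n-1} t + β_{n-2} t^2 + ⋯`,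
where `q` is the quotient of `n` by `r`. -/
noncomputable def betaPoly (n r i : ℕ) : CoeffPoly n r :=
  PowerSeries.coeff (n - i) (PowerSeries.invOfUnit (invB n r ^ (n / r) * seriesD n r) 1)

/-- The polynomials `ψ_{sr+i}` with `0 ≤ i < r`: `d_i` for `s = 0`, and
`(∂/∂b_0)^{s-1} (∂ d_{r-1} / ∂b_{r-1-i})` for `s ≥ 1`. -/
noncomputable def psiBlock (n r : ℕ) : ℕ → Fin r → CoeffPoly n r
  | 0, i => dPoly n r i
  | s + 1, i =>
      (fun p => MvPolynomial.pderiv (Sum.inr ⟨0, i.pos⟩) p)^[s]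
        (MvPolynomial.pderiv (Sum.inr i.rev) (dPoly n r (r - 1)))

/-- The polynomials `ψ_0, …, ψ_{n-1}` attached to `μ_{n,r}`, where `n = q r + ρ` is the division
with remainder of `n` by `r`: `ψ_k` for `k < q r` is given by `psiBlock`, and
`ψ_{qr+i} = β_{(q-1)r+ρ+i}` for `0 ≤ i < ρ`. -/
noncomputable def psi (n r k : ℕ) : CoeffPoly n r :=
  if hr : 0 < r then
    if k < n / r * r then psiBlock n r (k / r) ⟨k % r, Nat.mod_lt k hr⟩
    else betaPoly n r ((n / r - 1) * r + n % r + (k - n / r * r))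
  else 0

/-- The polynomials `φ_0, …, φ_{r-1}`: with `ρ` the remainder of `n` by `r`, they are the
polynomials `ψ_k` attached to `μ_{r,ρ}`, evaluated at the coefficients `b_0, …, b_{r-1}` of
`f_1(x) = g(x)` and the coefficients `γ_{n-ρ}, …, γ_{n-1}` of
`f_2(x) = x^ρ + γ_{n-1} x^{ρ-1} + ⋯ + γ_{n-ρ}`. -/
noncomputable def phi (n r k : ℕ) : CoeffPoly n r :=
  MvPolynomial.aeval
    (Sum.elim (fun j : Fin r => (MvPolynomial.X (Sum.inr j) : CoeffPoly n r))
      (fun j : Fin (n % r) => gammaPoly n r (n - n % r + (j : ℕ))))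
    (psi r (n % r) k)

/-- The ideal `I(μ_{n,r}) + (ψ_0, …, ψ_{u-1}, φ_0, …, φ_{v-1})`. -/
noncomputable def extendedIdeal (n r u v : ℕ) : Ideal (analyticGerms (Fin n ⊕ Fin r)) :=
  multIdeal n r ⊔
    Ideal.span ({h | ∃ k < u, h = polyGerm (psi n r k)} ∪ {h | ∃ k < v, h = polyGerm (phi n r k)})

end Multiplication

end ThomBoardman

/-!
Modulo an ideal containing `I(μ_{n,r})` the series `A` and `B` satisfy `A * B = 1`. More generally,
consider the scheme of pairs `(U, V)` of polynomials of degrees at most `u ≥ v` with constant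
term `1` such that `U ^ α * V ^ β = 1`, where the coefficients of `U` and `V` are coordinates. Its
tangent vectors `(δU, δV)` are the solutions of `α * V * δU + β * U * δV = 0`. Where `V` divides
`U`, say `U = V * W`, one may prescribe `δV` arbitrarily and solve for `δU = -(β / α) * W * δV`, so
that the tangent space has dimension `v`. Conversely, if a tangent vector with `δV = t ^ v` exists,
then `W * t ^ v = -(α / β) * δU` has degree at most `u`, and `U / V = W` has degree at most `u - v`.
The critical extension is therefore `Δ^v`, and it adds the condition that `V` divides `U`, replacing
`(U, V; α, β)` by `(U / V, V; α, α + β)`. Iterating this, and exchanging the roles of the two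
polynomials after each division with remainder, one runs the Euclidean algorithm.

The polynomials `ψ_k` and `φ_k` are, up to nonzero constants and modulo the preceding ones, the
coefficients which have to vanish for these quotients to be polynomials of the right degree, because
`∂/∂b_j` sends `B ^ (-k) * A` to `-k * t ^ (r - j) * B ^ (-k - 1) * A`.
-/

namespace ThomBoardman

/-! ### Minors of matrices -/

section Minors

variable {R : Type*} [CommRing R] {ι κ ν σ : Type*}

theorem det_mul_eq_zero_of_card_lt [Fintype σ] [Fintype κ] [DecidableEq κ]
    (h : Fintype.card σ < Fintype.card κ) (P : Matrix κ σ R) (Q : Matrix σ κ R) :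
    (P * Q).det = 0 := by
  obtain ⟨e⟩ := Function.Embedding.nonempty_of_card_le h.le
  obtain ⟨r, hr⟩ : ∃ r, r ∉ Set.range e := by
    by_contra! hsurj
    exact h.not_ge (Fintype.card_le_of_surjective e hsurj)
  have hPQ : P * Q = Matrix.of (fun i => Function.extend e (P i) 0) *
      Matrix.of (Function.extend e (fun s => Q s) 0) := by
    ext i j
    refine Fintype.sum_of_injective e e.injective _ _ (fun k hk => ?_) fun s => ?_
    · have hPk : Function.extend e (P i) 0 k = 0 := Function.extend_apply' _ _ _ hk
      exact mul_eq_zero_of_left hPk _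
    · simp only [Matrix.of_apply, e.injective.extend_apply]
  rw [hPQ, Matrix.det_mul, Matrix.det_eq_zero_of_column_eq_zero r
    (fun i => Function.extend_apply' _ _ _ hr), zero_mul]

theorem det_submatrix_eq_zero_of_mul_eq_zero [Fintype κ] [DecidableEq κ] [Fintype ν] [DecidableEq ν]
    [Fintype σ] (h : Fintype.card σ < Fintype.card κ + Fintype.card ν) {F : Matrix κ σ R}
    {W : Matrix σ ν R} {Y : Matrix ν σ R} (hF : F * W = 0) (hY : Y * W = 1) (c : κ → σ) :
    (F.submatrix id c).det = 0 := by
  classical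
  have hdet := det_mul_eq_zero_of_card_lt (by rwa [Fintype.card_sum]) (Matrix.fromRows F Y)
    (Matrix.fromCols ((1 : Matrix σ σ R).submatrix (Equiv.refl σ) c) W)
  rwa [Matrix.fromRows_mul_fromCols, hF, hY, Matrix.mul_submatrix_one,
    Matrix.det_fromBlocks_zero₁₂, Matrix.det_one, mul_one] at hdet

theorem isUnit_det_submatrix_map {S : Type*} [CommRing S] [Fintype ι] [DecidableEq ι]
    {F : Matrix ι σ R} {c : ι → σ} (hc : IsUnit (F.submatrix id c).det) (π : R →+* S) :
    IsUnit ((F.map π).submatrix id c).det := by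
  rw [Matrix.submatrix_map, ← RingHom.mapMatrix_apply, ← RingHom.map_det]
  exact hc.map π

theorem exists_vecMul_eq_of_bordered_minors [Fintype ι] [DecidableEq ι] (F : Matrix ι σ R)
    (c : ι → σ) (hc : IsUnit (F.submatrix id c).det) (f : σ → R)
    (hf : ∀ s : σ, ((Matrix.of (Sum.elim F fun _ : Unit => f)).submatrix id
      (Sum.elim c fun _ => s)).det = 0) :
    ∃ l : ι → R, Matrix.vecMul l F = f := by
  let _ := Matrix.invertibleOfIsUnitDet _ hc
  refine ⟨Matrix.vecMul (fun j => f (c j)) (⅟(F.submatrix id c)), funext fun s => ?_⟩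
  have hblocks : (Matrix.of (Sum.elim F fun _ : Unit => f)).submatrix id
      (Sum.elim c fun _ => s) =
      Matrix.fromBlocks (F.submatrix id c) (Matrix.of fun i (_ : Unit) => F i s)
        (Matrix.of fun (_ : Unit) j => f (c j)) (Matrix.of fun _ _ => f s) := by
    ext (i | i) (j | j) <;> rfl
  have hschur := hf s
  rw [hblocks, Matrix.det_fromBlocks₁₁, hc.mul_right_eq_zero, Matrix.det_unique,
    Matrix.sub_apply, sub_eq_zero] at hschur
  exact hschur.symm

theorem exists_isUnit_det_submatrix {K : Type*} [Field K] [Fintype ι] [DecidableEq ι] [Finite σ]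
    (F : Matrix ι σ K) (hF : LinearIndependent K F.row) :
    ∃ c : ι → σ, IsUnit (F.submatrix id c).det := by
  have := Fintype.ofFinite σ
  obtain ⟨κ, a, ha, hspan, hli⟩ := exists_linearIndependent' K F.col
  have := Fintype.ofInjective a ha
  have hcard : Fintype.card ι = Fintype.card κ := by
    rw [← hF.rank_matrix, Matrix.rank_eq_finrank_span_cols, ← hspan, finrank_span_eq_card hli]
  let e : ι ≃ κ := Fintype.equivOfCardEq hcard
  refine ⟨a ∘ e, ?_⟩
  rw [← Matrix.isUnit_iff_isUnit_det, ← Matrix.linearIndependent_cols_iff_isUnit]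
  exact hli.comp e e.injective

theorem exists_isUnit_det_submatrix_of_residue [IsLocalRing R] [Fintype ι] [DecidableEq ι]
    [Finite σ] (F : Matrix ι σ R)
    (hF : LinearIndependent (IsLocalRing.ResidueField R) (F.map (IsLocalRing.residue R)).row) :
    ∃ c : ι → σ, IsUnit (F.submatrix id c).det := by
  obtain ⟨c, hc⟩ := exists_isUnit_det_submatrix _ hF
  rw [Matrix.submatrix_map, ← RingHom.mapMatrix_apply, ← RingHom.map_det] at hc
  exact ⟨c, isUnit_of_map_unit _ _ hc⟩

theorem mulVec_surjective_of_isUnit_det_submatrix [Fintype ι] [DecidableEq ι] [Fintype σ]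
    (F : Matrix ι σ R) (c : ι → σ) (hc : IsUnit (F.submatrix id c).det) :
    Function.Surjective F.mulVec := by
  classical
  have hF : F * (1 : Matrix σ σ R).submatrix (Equiv.refl σ) c = F.submatrix id c :=
    Matrix.mul_submatrix_one _ _ _
  refine Matrix.mulVec_surjective_iff_exists_right_inverse.2
    ⟨(1 : Matrix σ σ R).submatrix (Equiv.refl σ) c * (F.submatrix id c)⁻¹, ?_⟩
  rw [← Matrix.mul_assoc, hF, Matrix.mul_nonsing_inv _ hc]

theorem exists_linearIndependent_of_existsUnique {K : Type*} [Field K] [Fintype ν] [Fintype σ]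
    (Φ : Set (σ → K)) (g : ν → σ → K)
    (hg : ∀ y : ν → K, ∃! x : σ → K, (∀ φ ∈ Φ, φ ⬝ᵥ x = 0) ∧ ∀ i, g i ⬝ᵥ x = y i) :
    ∃ k, k + Fintype.card ν = Fintype.card σ ∧
      ∃ φ : Fin k → Φ, LinearIndependent K (Sum.elim (fun i => (φ i : σ → K)) g) := by
  classical
  obtain ⟨Ψ, hΨΦ, hspan, hΨ⟩ := exists_linearIndependent K Φ
  have := hΨ.setFinite.fintype
  let w : Ψ ⊕ ν → σ → K := Sum.elim (fun ψ => (ψ : σ → K)) g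
  have hrows : LinearIndependent K w := by
    refine Fintype.linearIndependent_iff.2 fun e he => ?_
    simp only [w, Fintype.sum_sum_type, Sum.elim_inl, Sum.elim_inr] at he
    have hν : ∀ i, e (Sum.inr i) = 0 := fun i => by
      obtain ⟨x, ⟨hΦx, hgx⟩, -⟩ := hg (Pi.single i 1)
      have hΨx : ∀ ψ : Ψ, (ψ : σ → K) ⬝ᵥ x = 0 := fun ψ => hΦx ψ (hΨΦ ψ.2)
      simpa [add_dotProduct, sum_dotProduct, hΨx, hgx, Pi.single_apply] using congrArg (· ⬝ᵥ x) he
    simp only [hν, zero_smul, Finset.sum_const_zero, add_zero] at he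
    exact Sum.rec (Fintype.linearIndependent_iff.1 hΨ _ he) hν
  have hcols : LinearIndependent K (Matrix.of w).col := by
    refine Matrix.mulVec_injective_iff.1
      ((injective_iff_map_eq_zero (Matrix.of w).mulVecLin).2 fun x hx => ?_)
    have hΦx : Submodule.span K Φ ≤ LinearMap.ker ((dotProductBilin K K).flip x) := by
      rw [← hspan, Submodule.span_le]
      exact fun ψ hψ => congrFun hx (Sum.inl ⟨ψ, hψ⟩)
    exact (hg 0).unique ⟨fun φ hφ => hΦx (Submodule.subset_span hφ),
      fun i => congrFun hx (Sum.inr i)⟩ ⟨by simp, by simp⟩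
  have hcard : Fintype.card Ψ + Fintype.card ν = Fintype.card σ := by
    rw [← Fintype.card_sum, ← LinearIndependent.rank_matrix (M := Matrix.of w) hrows,
      ← Matrix.rank_transpose]
    exact LinearIndependent.rank_matrix (M := (Matrix.of w).transpose) hcols
  let e := (Fintype.equivFin Ψ).symm
  refine ⟨_, hcard, fun i => ⟨e i, hΨΦ (e i).2⟩, ?_⟩
  convert hrows.comp (Sum.map e id) (Sum.map_injective.2 ⟨e.injective, Function.injective_id⟩)
    using 1
  ext (i | i) <;> rfl

end Minors

/-! ### Jacobian extensions and tangent vectors -/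

section Tangent

variable {A : Type*} [CommRing A] {σ : Type*}

/-- The Jacobian matrix of a family of functions with respect to a family of derivations. -/
def jacobian (D : σ → Derivation ℤ A A) {ι : Type*} (f : ι → A) : Matrix ι σ A :=
  Matrix.of fun i s => D s (f i)

/-- The Jacobian extension `Δ_k J` with respect to a family of derivations of a commutative ring. -/
def jacExt (D : σ → Derivation ℤ A A) (k : ℕ) (J : Ideal A) : Ideal A :=
  J ⊔ Ideal.span {δ | ∃ (f : Fin k → J) (c : Fin k → σ),
    δ = ((jacobian D fun i => (f i : A)).submatrix id c).det}

/-- The tangent vector `∑ x_i ∂_i` at an `S`-valued point. -/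
noncomputable def tangent [Fintype σ] {S : Type*} [CommRing S] [Algebra A S]
    (D : σ → Derivation ℤ A A) (x : σ → S) : Derivation ℤ A S :=
  ∑ i, x i • (Algebra.linearMap A S).compDer (D i)

variable {D : σ → Derivation ℤ A A} {J : Ideal A}

theorem le_jacExt (k : ℕ) : J ≤ jacExt D k J :=
  le_sup_left

theorem jacExt_le_iff {k : ℕ} {K : Ideal A} :
    jacExt D k J ≤ K ↔ J ≤ K ∧ ∀ (f : Fin k → J) (c : Fin k → σ),
      ((jacobian D fun i => (f i : A)).submatrix id c).det ∈ K := by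
  rw [jacExt, sup_le_iff, Ideal.span_le]
  refine and_congr_right fun _ => ⟨fun h f c => h ⟨f, c, rfl⟩, ?_⟩
  rintro h _ ⟨f, c, rfl⟩
  exact h f c

theorem det_mem_jacExt (D : σ → Derivation ℤ A A) {κ : Type*} [Fintype κ] [DecidableEq κ]
    {k : ℕ} (hk : Fintype.card κ = k) (f : κ → J) (c : κ → σ) :
    ((jacobian D fun i => (f i : A)).submatrix id c).det ∈ jacExt D k J := by
  subst hk
  let e := Fintype.equivFin κ
  rw [← Matrix.det_submatrix_equiv_self e.symm]
  exact (jacExt_le_iff.1 le_rfl).2 (f ∘ e.symm) (c ∘ e.symm)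

theorem jacExt_antitone : Antitone fun k => jacExt D k J := by
  refine antitone_nat_of_succ_le fun k => jacExt_le_iff.2 ⟨le_jacExt k, fun f c => ?_⟩
  rw [Matrix.det_succ_row_zero]
  refine Ideal.sum_mem _ fun j _ => Ideal.mul_mem_left _ _ ?_
  exact (jacExt_le_iff.1 le_rfl).2 (f ∘ Fin.succ) (c ∘ j.succAbove)

variable [Fintype σ] {S : Type*} [CommRing S] [Algebra A S]

theorem tangent_apply (x : σ → S) {ι : Type*} (f : ι → A) (i : ι) :
    tangent D x (f i) = ((jacobian D f).map (algebraMap A S)).mulVec x i := by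
  rw [tangent, ← Derivation.coeFnAddMonoidHom_apply, map_sum, Finset.sum_apply]
  exact Finset.sum_congr rfl fun s _ => mul_comm _ _

/-- Tangent vectors dual to functions `g` exhibit a kernel of rank `|ν|` of the Jacobian matrix. -/
theorem jacExt_le_of_exists_tangent {ν : Type*} [Fintype ν] {K : Ideal A} (hJ : J ≤ K) {k : ℕ}
    (hk : Fintype.card σ < k + Fintype.card ν) (g : ν → A)
    (hg : ∀ y : ν → A ⧸ K, ∃ x : σ → A ⧸ K,
      (∀ f ∈ J, tangent D x f = 0) ∧ ∀ i, tangent D x (g i) = y i) :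
    jacExt D k J ≤ K := by
  classical
  choose x hxJ hxg using fun i => hg (Pi.single i 1)
  refine jacExt_le_iff.2 ⟨hJ, fun f c => ?_⟩
  rw [← Ideal.Quotient.eq_zero_iff_mem, RingHom.map_det]
  refine det_submatrix_eq_zero_of_mul_eq_zero (by simpa using hk)
    (F := (jacobian D fun i => (f i : A)).map (algebraMap A (A ⧸ K)))
    (W := (Matrix.of x).transpose) (Y := (jacobian D g).map (algebraMap A (A ⧸ K))) ?_ ?_ c
  · ext i j
    exact (tangent_apply (x j) (fun i => (f i : A)) i).symm.trans (hxJ j _ (f i).2)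
  · ext i j
    refine (tangent_apply (x j) g i).symm.trans ((hxg j i).trans ?_)
    rw [Pi.single_apply, Matrix.one_apply]

variable [IsLocalRing A] {ν : Type*} [Fintype ν] {g : ν → A}

theorem exists_frame [DecidableEq ν]
    (hg : ∀ y : ν → IsLocalRing.ResidueField A, ∃! x : σ → IsLocalRing.ResidueField A,
      (∀ f ∈ J, tangent D x f = 0) ∧ ∀ i, tangent D x (g i) = y i) :
    ∃ k, k + Fintype.card ν = Fintype.card σ ∧ ∃ f : Fin k → J,
      (∃ c, IsUnit ((jacobian D fun i => (f i : A)).submatrix id c).det) ∧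
      ∃ c, IsUnit ((jacobian D (Sum.elim (fun i => (f i : A)) g)).submatrix id c).det := by
  let d (f : A) : σ → IsLocalRing.ResidueField A := fun s => IsLocalRing.residue A (D s f)
  have hd (f : A) (x : σ → IsLocalRing.ResidueField A) : d f ⬝ᵥ x = tangent D x f :=
    (tangent_apply x (fun _ : Unit => f) ()).symm
  obtain ⟨k, hk, φ, hφ⟩ := exists_linearIndependent_of_existsUnique (d '' J) (d ∘ g) (by
    simpa only [Set.forall_mem_image, Function.comp_apply, hd] using! hg)
  choose f hfJ hfφ using fun i => (φ i).2
  refine ⟨k, hk, fun i => ⟨f i, hfJ i⟩, ?_, ?_⟩ <;>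
    refine exists_isUnit_det_submatrix_of_residue _ ?_
  · convert hφ.comp _ Sum.inl_injective using 1
    exact funext hfφ
  · convert hφ using 1
    ext (i | i) s
    · exact congrFun (hfφ i) s
    · rfl

theorem jacExt_eq_top_of_existsUnique {k : ℕ}
    (hg : ∀ y : ν → IsLocalRing.ResidueField A, ∃! x : σ → IsLocalRing.ResidueField A,
      (∀ f ∈ J, tangent D x f = 0) ∧ ∀ i, tangent D x (g i) = y i)
    (hk : k + Fintype.card ν ≤ Fintype.card σ) : jacExt D k J = ⊤ := by
  classical
  obtain ⟨l, hl, f, ⟨c, hc⟩, -⟩ := exists_frame hg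
  have hl_top : jacExt D l J = ⊤ := Ideal.eq_top_of_isUnit_mem _
    (det_mem_jacExt D (Fintype.card_fin l) f c) hc
  exact top_unique (hl_top.ge.trans (jacExt_antitone (show k ≤ l by omega)))

/-- The minors bordering an invertible minor of a frame vanish in `S`, so that the differentials of
all elements of `J` are combinations of those of the frame. -/
theorem exists_tangent_of_jacExt_le_ker {k : ℕ}
    (hg : ∀ y : ν → IsLocalRing.ResidueField A, ∃! x : σ → IsLocalRing.ResidueField A,
      (∀ f ∈ J, tangent D x f = 0) ∧ ∀ i, tangent D x (g i) = y i)
    (hk : k + Fintype.card ν = Fintype.card σ + 1)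
    (hS : jacExt D k J ≤ RingHom.ker (algebraMap A S)) (y : ν → S) :
    ∃ x : σ → S, (∀ f ∈ J, tangent D x f = 0) ∧ ∀ i, tangent D x (g i) = y i := by
  classical
  obtain ⟨l, hl, f, ⟨c, hc⟩, c', hc'⟩ := exists_frame hg
  obtain rfl : k = l + 1 := by omega
  let F := jacobian D fun i => (f i : A)
  obtain ⟨x, hx⟩ := mulVec_surjective_of_isUnit_det_submatrix _ c'
    (isUnit_det_submatrix_map hc' (algebraMap A S)) (Sum.elim 0 y)
  have hFx : (F.map (algebraMap A S)).mulVec x = 0 := funext fun i => congrFun hx (Sum.inl i)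
  refine ⟨x, fun h hh => ?_, fun i => ?_⟩
  · obtain ⟨a, ha⟩ := exists_vecMul_eq_of_bordered_minors (F.map (algebraMap A S)) c
      (isUnit_det_submatrix_map hc _) (fun s => algebraMap A S (D s h)) fun s => by
        have hdet := hS (det_mem_jacExt D (by simp) (Sum.elim f fun _ : Unit => ⟨h, hh⟩)
          (Sum.elim c fun _ => s))
        rw [RingHom.mem_ker, RingHom.map_det] at hdet
        convert hdet using 2
        ext (i | i) j <;> rfl
    calc tangent D x h = (fun s => algebraMap A S (D s h)) ⬝ᵥ x :=
          tangent_apply x (fun _ : Unit => h) ()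
      _ = 0 := by rw [← ha, ← Matrix.dotProduct_mulVec, hFx, dotProduct_zero]
  · exact (tangent_apply x _ (Sum.inr i)).trans (congrFun hx (Sum.inr i))

end Tangent

open PowerSeries

/-! ### Pairs of polynomials -/

section Series

variable {S : Type*} [CommRing S]

/-- The power series which are polynomials of degree at most `d`. -/
def degreeLE (S : Type*) [CommRing S] (d : ℕ) : Submodule S S⟦X⟧ where
  carrier := {W | ∀ j, d < j → coeff j W = 0}
  zero_mem' _ _ := map_zero _
  add_mem' hW hZ j hj := by rw [map_add, hW j hj, hZ j hj, add_zero]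
  smul_mem' a W hW j hj := by rw [map_smul, hW j hj, smul_zero]

theorem mem_degreeLE {W : S⟦X⟧} {d : ℕ} : W ∈ degreeLE S d ↔ ∀ j, d < j → coeff j W = 0 :=
  Iff.rfl

theorem X_pow_mem_degreeLE {c d : ℕ} (h : c ≤ d) : (X ^ c : S⟦X⟧) ∈ degreeLE S d :=
  fun j hj => by rw [coeff_X_pow, if_neg (by omega)]

theorem one_mem_degreeLE (d : ℕ) : (1 : S⟦X⟧) ∈ degreeLE S d := by
  simpa using X_pow_mem_degreeLE (S := S) d.zero_le

theorem mul_mem_degreeLE {W Z : S⟦X⟧} {c d : ℕ} (hW : W ∈ degreeLE S c) (hZ : Z ∈ degreeLE S d) :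
    W * Z ∈ degreeLE S (c + d) := by
  intro j hj
  rw [coeff_mul]
  refine Finset.sum_eq_zero fun p hp => ?_
  have hp : p.1 + p.2 = j := Finset.HasAntidiagonal.mem_antidiagonal.1 hp
  rcases lt_or_ge c p.1 with h | h
  · rw [hW _ h, zero_mul]
  · rw [hZ _ (by omega), mul_zero]

theorem mem_degreeLE_of_mul_mem {V W : S⟦X⟧} {u v : ℕ} (hV : V ∈ degreeLE S v)
    (hV1 : constantCoeff V = 1) (hVW : V * W ∈ degreeLE S (u + v))
    (hW : ∀ j ∈ Set.Ioc u (u + v), coeff j W = 0) : W ∈ degreeLE S u := by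
  intro j
  induction j using Nat.strong_induction_on with
  | _ j ih =>
    intro hj
    rcases le_or_gt j (u + v) with h | h
    · exact hW j ⟨hj, h⟩
    have hsum := hVW j h
    rw [coeff_mul, Finset.sum_eq_single (0, j)] at hsum
    · simpa [hV1] using hsum
    · rintro ⟨a, b⟩ hab hne
      have hab : a + b = j := Finset.HasAntidiagonal.mem_antidiagonal.1 hab
      rcases lt_or_ge v a with hva | hva
      · rw [hV a hva, zero_mul]
      · have ha : a ≠ 0 := by rintro rfl; simp_all
        rw [ih b (by omega) (by omega), mul_zero]
    · simp

theorem eq_of_mem_degreeLE {W Z : S⟦X⟧} {d : ℕ} (hW : W ∈ degreeLE S d) (hZ : Z ∈ degreeLE S d)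
    (h0 : constantCoeff W = constantCoeff Z)
    (h : ∀ i : Fin d, coeff (d - i : ℕ) W = coeff (d - i : ℕ) Z) : W = Z := by
  ext j
  rcases lt_or_ge d j with hj | hj
  · rw [hW j hj, hZ j hj]
  · rcases j.eq_zero_or_pos with rfl | hj0
    · simpa only [coeff_zero_eq_constantCoeff_apply] using h0
    · simpa only [Nat.sub_sub_self hj] using h ⟨d - j, by omega⟩

/-- The series `1 + c_{d-1} t + ⋯ + c_0 t^d`, which is the monic polynomial
`x^d + c_{d-1} x^{d-1} + ⋯ + c_0` read backwards. -/
noncomputable def monicSeries {d : ℕ} (c : Fin d → S) : S⟦X⟧ :=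
  1 + ∑ i : Fin d, C (c i) * X ^ (d - i : ℕ)

theorem coeff_monicSeries {d : ℕ} (c : Fin d → S) (i : Fin d) :
    coeff (d - i : ℕ) (monicSeries c) = c i := by
  rw [monicSeries, map_add, map_sum, coeff_one, if_neg (by omega), zero_add,
    Finset.sum_eq_single i]
  · simp
  · intro j _ hj
    rw [coeff_C_mul, coeff_X_pow, if_neg, mul_zero]
    rw [Ne, Fin.ext_iff] at hj
    omega
  · simp

theorem constantCoeff_monicSeries {d : ℕ} (c : Fin d → S) :
    constantCoeff (monicSeries c) = 1 := by
  rw [monicSeries, map_add, map_sum, map_one, Finset.sum_eq_zero, add_zero]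
  intro i _
  rw [map_mul, map_pow, constantCoeff_X, zero_pow (by omega), mul_zero]

theorem monicSeries_mem_degreeLE {d : ℕ} (c : Fin d → S) : monicSeries c ∈ degreeLE S d := by
  refine add_mem (one_mem_degreeLE d) (sum_mem fun i _ => ?_)
  rw [← smul_eq_C_mul]
  exact Submodule.smul_mem _ _ (X_pow_mem_degreeLE (Nat.sub_le d i))

theorem exists_mem_degreeLE {d : ℕ} (y : Fin d → S) :
    ∃ Y ∈ degreeLE S d, constantCoeff Y = 0 ∧ ∀ i : Fin d, coeff (d - i : ℕ) Y = y i := by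
  refine ⟨monicSeries y - 1, sub_mem (monicSeries_mem_degreeLE y) (one_mem_degreeLE d), ?_, ?_⟩
  · rw [map_sub, constantCoeff_monicSeries, map_one, sub_self]
  · intro i
    rw [map_sub, coeff_monicSeries, coeff_one, if_neg (by omega), sub_zero]

theorem isUnit_of_constantCoeff_eq_one {V : S⟦X⟧} (hV : constantCoeff V = 1) : IsUnit V :=
  isUnit_iff_constantCoeff.2 (hV ▸ isUnit_one)

variable {A : Type*} [CommRing A]

theorem constantCoeff_map_eq_one {W : A⟦X⟧} (hW : constantCoeff W = 1) (π : A →+* S) :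
    constantCoeff (PowerSeries.map π W) = 1 := by
  rw [← coeff_zero_eq_constantCoeff_apply] at hW ⊢
  rw [coeff_map, hW, map_one]

theorem map_monicSeries (π : A →+* S) {d : ℕ} (c : Fin d → A) :
    PowerSeries.map π (monicSeries c) = monicSeries (π ∘ c) := by
  simp [monicSeries]

variable [Algebra A S]

/-- A derivation applied to the coefficients of power series. -/
noncomputable def coeffwise (δ : Derivation ℤ A S) : Derivation ℤ A⟦X⟧ S⟦X⟧ where
  toFun W := PowerSeries.mk fun j => δ (coeff j W)
  map_add' W Z := by ext; simp
  map_smul' k W := by ext; simp [-zsmul_eq_mul]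
  map_one_eq_zero' := by ext; simp [coeff_one, apply_ite δ]
  leibniz' W Z := by
    refine PowerSeries.ext fun j => ?_
    change coeff j (PowerSeries.mk fun j => δ (coeff j (W * Z))) = coeff j
      (PowerSeries.map (algebraMap A S) W * PowerSeries.mk (fun j => δ (coeff j Z)) +
        PowerSeries.map (algebraMap A S) Z * PowerSeries.mk fun j => δ (coeff j W))
    rw [mul_comm (PowerSeries.map (algebraMap A S) Z)]
    simp only [map_add, coeff_mul, coeff_mk, coeff_map, map_sum, Derivation.leibniz,
      Algebra.smul_def, Finset.sum_add_distrib, mul_comm (δ _)]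

theorem coeff_coeffwise (δ : Derivation ℤ A S) (W : A⟦X⟧) (j : ℕ) :
    coeff j (coeffwise δ W) = δ (coeff j W) :=
  coeff_mk j fun j => δ (coeff j W)

theorem constantCoeff_coeffwise (δ : Derivation ℤ A S) {W : A⟦X⟧} (hW : constantCoeff W = 1) :
    constantCoeff (coeffwise δ W) = 0 := by
  rw [← coeff_zero_eq_constantCoeff_apply] at hW ⊢
  rw [coeff_coeffwise, hW, Derivation.map_one_eq_zero]

theorem coeffwise_mem_degreeLE (δ : Derivation ℤ A S) {W : A⟦X⟧} {d : ℕ}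
    (hW : W ∈ degreeLE A d) : coeffwise δ W ∈ degreeLE S d := fun j hj => by
  rw [coeff_coeffwise, hW j hj, map_zero]

theorem coeffwise_monicSeries_eq_iff (δ : Derivation ℤ A S) {d : ℕ} (c : Fin d → A) {Y : S⟦X⟧}
    (hY : Y ∈ degreeLE S d) (hY0 : constantCoeff Y = 0) :
    coeffwise δ (monicSeries c) = Y ↔ ∀ i : Fin d, δ (c i) = coeff (d - i : ℕ) Y := by
  refine ⟨fun h i => by rw [← h, coeff_coeffwise, coeff_monicSeries], fun h => ?_⟩
  have hc := coeffwise_mem_degreeLE δ (monicSeries_mem_degreeLE c)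
  refine eq_of_mem_degreeLE hc hY ?_ fun i => ?_
  · rw [constantCoeff_coeffwise δ (constantCoeff_monicSeries c), hY0]
  · rw [coeff_coeffwise, coeff_monicSeries, h]

theorem coeffwise_mul (δ : Derivation ℤ A S) (W Z : A⟦X⟧) :
    coeffwise δ (W * Z) = PowerSeries.map (algebraMap A S) W * coeffwise δ Z +
      PowerSeries.map (algebraMap A S) Z * coeffwise δ W :=
  (coeffwise δ).leibniz W Z

theorem coeffwise_pow (δ : Derivation ℤ A S) (W : A⟦X⟧) (k : ℕ) :
    coeffwise δ (W ^ k) =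
      k * PowerSeries.map (algebraMap A S) W ^ (k - 1) * coeffwise δ W := by
  rw [Derivation.leibniz_pow, nsmul_eq_mul, ← map_pow, mul_assoc]
  rfl

theorem derivation_eq_zero_on_span_iff (δ : Derivation ℤ A S) {G : Set A}
    (hG : Ideal.span G ≤ RingHom.ker (algebraMap A S)) :
    (∀ f ∈ Ideal.span G, δ f = 0) ↔ ∀ g ∈ G, δ g = 0 := by
  refine ⟨fun h g hg => h g (Ideal.subset_span hg), fun h f hf => ?_⟩
  induction hf using Submodule.span_induction with
  | mem g hg => exact h g hg
  | zero => exact map_zero δ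
  | add f g _ _ hf hg => rw [map_add, hf, hg, add_zero]
  | smul a f hf h0 =>
    rw [smul_eq_mul, Derivation.leibniz, h0, smul_zero, zero_add, Algebra.smul_def,
      RingHom.mem_ker.1 (hG hf), zero_mul]

end Series

section PairIdeal

variable {A S : Type*} [CommRing A] [CommRing S] {U V W : A⟦X⟧} {u v α β : ℕ}

/-- The ideal of the scheme of points at which `U` and `V` become polynomials of degrees at most
`u` and `v` such that `U ^ α * V ^ β = 1`. -/
def pairIdeal (U V : A⟦X⟧) (u v α β : ℕ) : Ideal A :=
  Ideal.span ((fun j => coeff j U) '' Set.Ioi u ∪ (fun j => coeff j V) '' Set.Ioi v ∪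
    Set.range fun j => coeff j (U ^ α * V ^ β - 1))

theorem pairIdeal_comm : pairIdeal U V u v α β = pairIdeal V U v u β α := by
  rw [pairIdeal, pairIdeal, Set.union_comm (_ '' Set.Ioi u), mul_comm (U ^ α)]

theorem pairIdeal_le_ker_iff {π : A →+* S} :
    pairIdeal U V u v α β ≤ RingHom.ker π ↔
      PowerSeries.map π U ∈ degreeLE S u ∧ PowerSeries.map π V ∈ degreeLE S v ∧
        PowerSeries.map π U ^ α * PowerSeries.map π V ^ β = 1 := by
  rw [← map_pow, ← map_pow, ← map_mul, ← sub_eq_zero, ← map_one (PowerSeries.map π), ← map_sub,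
    PowerSeries.ext_iff]
  simp only [pairIdeal, Ideal.span_le, Set.union_subset_iff, Set.image_subset_iff,
    Set.range_subset_iff, coeff_map, map_zero, and_assoc, mem_degreeLE]
  rfl

theorem derivation_eq_zero_on_pairIdeal_iff [Algebra A S] (hα : α ≠ 0) (hβ : β ≠ 0)
    (hS : pairIdeal U V u v α β ≤ RingHom.ker (algebraMap A S)) (δ : Derivation ℤ A S) :
    (∀ f ∈ pairIdeal U V u v α β, δ f = 0) ↔
      coeffwise δ U ∈ degreeLE S u ∧ coeffwise δ V ∈ degreeLE S v ∧
        α * PowerSeries.map (algebraMap A S) V * coeffwise δ U +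
          β * PowerSeries.map (algebraMap A S) U * coeffwise δ V = 0 := by
  obtain ⟨a, rfl⟩ := Nat.exists_eq_add_one_of_ne_zero hα
  obtain ⟨b, rfl⟩ := Nat.exists_eq_add_one_of_ne_zero hβ
  have hUV := (pairIdeal_le_ker_iff.1 hS).2.2
  set U₀ := PowerSeries.map (algebraMap A S) U
  set V₀ := PowerSeries.map (algebraMap A S) V
  have hunit : IsUnit (U₀ ^ a * V₀ ^ b) := .of_mul_eq_one (U₀ * V₀) (by rw [← hUV]; ring)
  have hδ : coeffwise δ (U ^ (a + 1) * V ^ (b + 1) - 1) = U₀ ^ a * V₀ ^ b *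
      ((a + 1 : ℕ) * V₀ * coeffwise δ U + (b + 1 : ℕ) * U₀ * coeffwise δ V) := by
    rw [map_sub, Derivation.map_one_eq_zero, coeffwise_mul, coeffwise_pow, coeffwise_pow,
      map_pow, map_pow, Nat.add_sub_cancel, Nat.add_sub_cancel]
    ring
  rw [pairIdeal, derivation_eq_zero_on_span_iff δ hS, ← hunit.mul_right_eq_zero, ← hδ]
  simp only [Set.mem_union, or_imp, forall_and, Set.forall_mem_image, Set.forall_mem_range,
    PowerSeries.ext_iff, map_zero, coeff_coeffwise, mem_degreeLE, and_assoc]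
  rfl

theorem pairIdeal_mul_sup_span (hV : constantCoeff V = 1) :
    pairIdeal (V * W) V (u + v) v α β ⊔ Ideal.span ((fun j => coeff j W) '' Set.Ioc u (u + v)) =
      pairIdeal W V u v α (α + β) := by
  refine eq_of_forall_ge_iff fun K => ?_
  rw [← Ideal.mk_ker (I := K), sup_le_iff, pairIdeal_le_ker_iff, pairIdeal_le_ker_iff, map_mul]
  set V₀ := PowerSeries.map (Ideal.Quotient.mk K) V
  set W₀ := PowerSeries.map (Ideal.Quotient.mk K) W
  have hpow : (V₀ * W₀) ^ α * V₀ ^ β = W₀ ^ α * V₀ ^ (α + β) := by ring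
  rw [hpow, Ideal.span_le, Set.image_subset_iff]
  constructor
  · rintro ⟨⟨hVW, hVv, hrel⟩, hW⟩
    have hV₀ : constantCoeff V₀ = 1 := constantCoeff_map_eq_one hV _
    refine ⟨mem_degreeLE_of_mul_mem hVv hV₀ hVW fun j hj => ?_, hVv, hrel⟩
    exact (coeff_map _ _ _).trans (hW hj)
  · rintro ⟨hWu, hVv, hrel⟩
    refine ⟨⟨add_comm v u ▸ mul_mem_degreeLE hVv hWu, hVv, hrel⟩, fun j hj => ?_⟩
    exact (coeff_map _ _ _).symm.trans (hWu j hj.1)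

end PairIdeal

section CoordinatePair

universe w

variable {A : Type w} [CommRing A] [IsLocalRing A] {σ : Type*} [Fintype σ]
  {D : σ → Derivation ℤ A A} {U V W : A⟦X⟧} {u v α β : ℕ}

/-- Two deformations `U` and `V` of the series `1` which can be moved independently along the
scheme cut out by `pairIdeal U V u v α β`: a tangent vector of the ambient space at a point of this
scheme is the same thing as a variation of `U` and of `V` among the polynomials of degrees at most
`u` and `v` with constant term `1`. -/
structure IsCoordinatePair (D : σ → Derivation ℤ A A) (U V : A⟦X⟧) (u v α β : ℕ) : Prop where
  constantCoeff_left : constantCoeff U = 1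
  constantCoeff_right : constantCoeff V = 1
  map_residue_left : PowerSeries.map (IsLocalRing.residue A) U = 1
  map_residue_right : PowerSeries.map (IsLocalRing.residue A) V = 1
  left_ne_zero : α ≠ 0
  right_ne_zero : β ≠ 0
  existsUnique_tangent : ∀ (S : Type w) [CommRing S] [Algebra A S],
    pairIdeal U V u v α β ≤ RingHom.ker (algebraMap A S) →
      ∀ U' ∈ degreeLE S u, ∀ V' ∈ degreeLE S v, constantCoeff U' = 0 → constantCoeff V' = 0 →
        ∃! x : σ → S, coeffwise (tangent D x) U = U' ∧ coeffwise (tangent D x) V = V'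

theorem isUnit_natCast_of_algebraRat {A S : Type*} [CommRing A] [CommRing S] [Algebra ℚ A]
    [Algebra A S] {k : ℕ} (hk : k ≠ 0) : IsUnit (k : S) := by
  have hℚ : IsUnit (k : ℚ) := (Nat.cast_ne_zero.2 hk).isUnit
  simpa using hℚ.map ((algebraMap A S).comp (algebraMap ℚ A))

namespace IsCoordinatePair

theorem symm (h : IsCoordinatePair D U V u v α β) : IsCoordinatePair D V U v u β α where
  constantCoeff_left := h.constantCoeff_right
  constantCoeff_right := h.constantCoeff_left
  map_residue_left := h.map_residue_right
  map_residue_right := h.map_residue_left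
  left_ne_zero := h.right_ne_zero
  right_ne_zero := h.left_ne_zero
  existsUnique_tangent S _ _ hS V' hV' U' hU' hV0 hU0 := by
    simpa only [and_comm] using
      h.existsUnique_tangent S (pairIdeal_comm.trans_le hS) U' hU' V' hV' hU0 hV0

theorem pairIdeal_ne_top (h : IsCoordinatePair D U V u v α β) : pairIdeal U V u v α β ≠ ⊤ := by
  refine ne_top_of_le_ne_top (RingHom.ker_ne_top (IsLocalRing.residue A))
    (pairIdeal_le_ker_iff.2 ?_)
  rw [h.map_residue_left, h.map_residue_right, one_pow, one_pow, one_mul]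
  exact ⟨one_mem_degreeLE u, one_mem_degreeLE v, rfl⟩

theorem quotient (h : IsCoordinatePair D (V * W) V (u + v) v α β) :
    IsCoordinatePair D W V u v α (α + β) where
  constantCoeff_left := by simpa [h.constantCoeff_right] using h.constantCoeff_left
  constantCoeff_right := h.constantCoeff_right
  map_residue_left := by simpa [h.map_residue_right] using h.map_residue_left
  map_residue_right := h.map_residue_right
  left_ne_zero := h.left_ne_zero
  right_ne_zero := by have := h.left_ne_zero; omega
  existsUnique_tangent S _ _ hS W' hW' V' hV' hW0 hV0 := by
    obtain ⟨hW, hV, -⟩ := pairIdeal_le_ker_iff.1 hS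
    have hunit := isUnit_of_constantCoeff_eq_one
      (constantCoeff_map_eq_one h.constantCoeff_right (algebraMap A S))
    refine (existsUnique_congr fun x => ?_).1 (h.existsUnique_tangent S
      ((le_sup_left.trans (pairIdeal_mul_sup_span h.constantCoeff_right).le).trans hS)
      (PowerSeries.map (algebraMap A S) V * W' + PowerSeries.map (algebraMap A S) W * V')
      (add_mem (add_comm v u ▸ mul_mem_degreeLE hV hW') (mul_mem_degreeLE hW hV')) V' hV'
      (by simp [hW0, hV0]) hV0)
    refine and_congr_left fun hx => ?_
    rw [coeffwise_mul, hx, add_left_inj, hunit.mul_right_inj]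

variable [Algebra ℚ A]

theorem existsUnique_tangent_coeff (h : IsCoordinatePair D (V * W) V (u + v) v α β)
    {S : Type w} [CommRing S] [Algebra A S]
    (hS : pairIdeal W V u v α (α + β) ≤ RingHom.ker (algebraMap A S)) (y : Fin v → S) :
    ∃! x : σ → S, (∀ f ∈ pairIdeal (V * W) V (u + v) v α β, tangent D x f = 0) ∧
      ∀ i : Fin v, tangent D x (coeff (v - i : ℕ) V) = y i := by
  obtain ⟨hW, hV, -⟩ := pairIdeal_le_ker_iff.1 hS
  have hS' := (le_sup_left.trans (pairIdeal_mul_sup_span h.constantCoeff_right).le).trans hS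
  set V₀ := PowerSeries.map (algebraMap A S) V
  set W₀ := PowerSeries.map (algebraMap A S) W
  have hV₀ : IsUnit V₀ := isUnit_of_constantCoeff_eq_one
    (constantCoeff_map_eq_one h.constantCoeff_right (algebraMap A S))
  obtain ⟨Y, hY, hY0, hYy⟩ := exists_mem_degreeLE y
  have hYW : Y * W₀ ∈ degreeLE S (u + v) := add_comm v u ▸ mul_mem_degreeLE hY hW
  obtain ⟨a, ha⟩ := (isUnit_natCast_of_algebraRat (A := A) (S := S) h.left_ne_zero).exists_left_inv
  have haC : C a * (α : S⟦X⟧) = 1 := by rw [← map_natCast C α, ← map_mul, ha, map_one]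
  refine (existsUnique_congr fun x => ?_).1 (h.existsUnique_tangent S hS'
    ((-(a * β)) • (Y * W₀)) (Submodule.smul_mem _ _ hYW) Y hY (by simp [hY0]) hY0)
  rw [derivation_eq_zero_on_pairIdeal_iff h.left_ne_zero h.right_ne_zero hS']
  set δ := tangent D x
  rw [map_mul (PowerSeries.map _)]
  constructor
  · rintro ⟨hU, hVY⟩
    refine ⟨⟨hU ▸ Submodule.smul_mem _ _ hYW, hVY ▸ hY, ?_⟩, fun i => ?_⟩
    · rw [hU, hVY, smul_eq_C_mul, map_neg, map_mul C, map_natCast]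
      linear_combination (-(β : S⟦X⟧) * V₀ * Y * W₀) * haC
    · rw [← coeff_coeffwise, hVY, hYy]
  · rintro ⟨⟨-, hδV, hrel⟩, hy⟩
    have hVY : coeffwise δ V = Y := by
      refine eq_of_mem_degreeLE hδV hY ?_ fun i => ?_
      · rw [constantCoeff_coeffwise δ h.constantCoeff_right, hY0]
      · rw [coeff_coeffwise, hy, hYy]
    refine ⟨hV₀.mul_left_cancel ?_, hVY⟩
    rw [hVY] at hrel
    rw [smul_eq_C_mul, map_neg, map_mul C, map_natCast]
    linear_combination C a * hrel - V₀ * coeffwise δ (V * W) * haC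

theorem existsUnique_residue_tangent_coeff (h : IsCoordinatePair D (V * W) V (u + v) v α β)
    (y : Fin v → IsLocalRing.ResidueField A) :
    ∃! x : σ → IsLocalRing.ResidueField A,
      (∀ f ∈ pairIdeal (V * W) V (u + v) v α β, tangent D x f = 0) ∧
        ∀ i : Fin v, tangent D x (coeff (v - i : ℕ) V) = y i :=
  h.existsUnique_tangent_coeff
    ((IsLocalRing.le_maximalIdeal h.quotient.pairIdeal_ne_top).trans (IsLocalRing.ker_residue).ge) y

theorem jacExt_eq_top (h : IsCoordinatePair D (V * W) V (u + v) v α β) {k : ℕ}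
    (hk : k + v ≤ Fintype.card σ) : jacExt D k (pairIdeal (V * W) V (u + v) v α β) = ⊤ :=
  jacExt_eq_top_of_existsUnique h.existsUnique_residue_tangent_coeff (by simpa using hk)

theorem le_card (h : IsCoordinatePair D (V * W) V (u + v) v α β) : v ≤ Fintype.card σ := by
  obtain ⟨k, hk, -⟩ := exists_frame h.existsUnique_residue_tangent_coeff
  rw [Fintype.card_fin] at hk
  omega

/-- A tangent vector with `δV = X ^ v` satisfies `α * δU + β * W * X ^ v = 0`, where `U = V * W`, so
that the degree of `W` is at most `u`. -/
theorem coeff_mem_jacExt (h : IsCoordinatePair D (V * W) V (u + v) v α β) {k : ℕ}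
    (hk : k + v = Fintype.card σ + 1) {j : ℕ} (hj : j ∈ Set.Ioc u (u + v)) :
    coeff j W ∈ jacExt D k (pairIdeal (V * W) V (u + v) v α β) := by
  set K := jacExt D k (pairIdeal (V * W) V (u + v) v α β)
  have hK : K ≤ RingHom.ker (algebraMap A (A ⧸ K)) := Ideal.mk_ker.ge
  obtain ⟨x, hxJ, hxV⟩ := exists_tangent_of_jacExt_le_ker h.existsUnique_residue_tangent_coeff
    (by simpa using hk) hK fun i => coeff (v - i : ℕ) (X ^ v)
  obtain ⟨hδU, hδV, hrel⟩ := (derivation_eq_zero_on_pairIdeal_iff h.left_ne_zero h.right_ne_zero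
    ((le_jacExt k).trans hK) _).1 hxJ
  set δ := tangent D x
  have hVX : coeffwise δ V = X ^ v := by
    refine eq_of_mem_degreeLE hδV (X_pow_mem_degreeLE le_rfl) ?_ fun i => ?_
    · rw [constantCoeff_coeffwise δ h.constantCoeff_right, map_pow, constantCoeff_X, zero_pow]
      rintro rfl
      simp at hj
    · rw [coeff_coeffwise, hxV]
  set V₀ := PowerSeries.map (algebraMap A (A ⧸ K)) V
  set W₀ := PowerSeries.map (algebraMap A (A ⧸ K)) W
  have hV₀ : IsUnit V₀ := isUnit_of_constantCoeff_eq_one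
    (constantCoeff_map_eq_one h.constantCoeff_right (algebraMap A (A ⧸ K)))
  have hWX : C (α : A ⧸ K) * coeffwise δ (V * W) + C (β : A ⧸ K) * (W₀ * X ^ v) = 0 := by
    rw [← hV₀.mul_right_eq_zero, ← hrel, hVX, map_mul (PowerSeries.map _), map_natCast, map_natCast]
    ring
  have hcoeff := congrArg (coeff (j + v)) hWX
  rw [map_add, coeff_C_mul, coeff_C_mul, hδU _ (by have := hj.1; omega), mul_zero, zero_add,
    coeff_mul_X_pow, map_zero] at hcoeff
  rw [← Ideal.Quotient.eq_zero_iff_mem]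
  exact (coeff_map _ _ _).symm.trans
    ((isUnit_natCast_of_algebraRat (A := A) h.right_ne_zero).mul_right_eq_zero.1 hcoeff)

theorem jacExt_eq (h : IsCoordinatePair D (V * W) V (u + v) v α β) {k : ℕ}
    (hk : k + v = Fintype.card σ + 1) :
    jacExt D k (pairIdeal (V * W) V (u + v) v α β) = pairIdeal W V u v α (α + β) := by
  refine le_antisymm (jacExt_le_of_exists_tangent
    (le_sup_left.trans (pairIdeal_mul_sup_span h.constantCoeff_right).le)
    (by rw [Fintype.card_fin]; omega)
    (fun i : Fin v => coeff (v - i : ℕ) V) fun y => ?_) ?_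
  · exact (h.existsUnique_tangent_coeff (S := A ⧸ pairIdeal W V u v α (α + β))
      Ideal.mk_ker.ge y).exists
  · rw [← pairIdeal_mul_sup_span h.constantCoeff_right, sup_le_iff, Ideal.span_le,
      Set.image_subset_iff]
    exact ⟨le_jacExt k, fun j hj => h.coeff_mem_jacExt hk hj⟩

theorem sInf_eq (h : IsCoordinatePair D (V * W) V (u + v) v α β) :
    sInf {k | jacExt D k (pairIdeal (V * W) V (u + v) v α β) ≠ ⊤} = Fintype.card σ + 1 - v := by
  have hv := h.le_card
  have hmem : jacExt D (Fintype.card σ + 1 - v) (pairIdeal (V * W) V (u + v) v α β) ≠ ⊤ := by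
    rw [h.jacExt_eq (by omega)]
    exact h.quotient.pairIdeal_ne_top
  refine le_antisymm (Nat.sInf_le hmem) (le_csInf ⟨_, hmem⟩ fun k hk => ?_)
  by_contra hlt
  exact hk (h.jacExt_eq_top (by omega))

end IsCoordinatePair

end CoordinatePair

section Iteration

universe w

variable {A : Type w} [CommRing A] {U V W : A⟦X⟧} {u v α β : ℕ}

theorem image_sub_Iio (d v : ℕ) : (fun k => d + v - k) '' Set.Iio v = Set.Ioc d (d + v) := by
  ext j
  simp only [Set.mem_image, Set.mem_Iio, Set.mem_Ioc]
  exact ⟨by rintro ⟨k, hk, rfl⟩; omega, fun hj => ⟨d + v - j, by omega, by omega⟩⟩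

theorem Iio_union_image_add (a b : ℕ) : Set.Iio a ∪ (· + a) '' Set.Iio b = Set.Iio (a + b) := by
  ext k
  simp only [Set.mem_union, Set.mem_image, Set.mem_Iio]
  refine ⟨by rintro (hk | ⟨k, hk, rfl⟩) <;> omega, fun hk => or_iff_not_imp_left.2 fun hka => ?_⟩
  exact ⟨k - a, by omega, by omega⟩

theorem pairIdeal_pow_mul_sup_span (hV : constantCoeff V = 1) (s : ℕ) :
    pairIdeal (V ^ s * W) V (u + s * v) v α β ⊔
        Ideal.span ((fun k => coeff (u + s * v - k) (V ^ (s - (k / v + 1)) * W)) ''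
          Set.Iio (s * v)) =
      pairIdeal W V u v α (s * α + β) := by
  induction s generalizing β with
  | zero => simp
  | succ s ih =>
    have hd : u + (s + 1) * v = u + s * v + v := by ring
    have hfirst : (fun k => coeff (u + (s + 1) * v - k) (V ^ (s + 1 - (k / v + 1)) * W)) ''
        Set.Iio v = (fun j => coeff j (V ^ s * W)) '' Set.Ioc (u + s * v) (u + s * v + v) := by
      rw [← image_sub_Iio, Set.image_image]
      refine Set.image_congr fun k hk => ?_
      rw [Nat.div_eq_of_lt hk, zero_add, Nat.add_sub_cancel, hd]
    have hrest : (fun k => coeff (u + (s + 1) * v - (k + v)) (V ^ (s + 1 - ((k + v) / v + 1)) * W))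
        '' Set.Iio (s * v) =
          (fun k => coeff (u + s * v - k) (V ^ (s - (k / v + 1)) * W)) '' Set.Iio (s * v) := by
      refine Set.image_congr fun k hk => ?_
      have hv : 0 < v := Nat.pos_of_mul_pos_left ((Nat.zero_le k).trans_lt hk)
      rw [Nat.add_div_right k hv, hd, Nat.add_sub_add_right, Nat.add_sub_add_right]
    rw [add_one_mul s v, add_comm (s * v) v, ← Iio_union_image_add, Set.image_union,
      Set.image_image, add_comm v (s * v), ← add_one_mul s v, hfirst, hrest, Ideal.span_union,
      ← sup_assoc, pow_succ', mul_assoc, hd, pairIdeal_mul_sup_span hV, ih]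
    congr 1
    ring

variable [IsLocalRing A] {σ : Type*} [Fintype σ] {D : σ → Derivation ℤ A A}

theorem IsCoordinatePair.quotient_pow {s : ℕ}
    (h : IsCoordinatePair D (V ^ s * W) V (u + s * v) v α β) :
    IsCoordinatePair D W V u v α (s * α + β) := by
  induction s generalizing β with
  | zero => simpa using h
  | succ s ih =>
    have hstep : IsCoordinatePair D (V * (V ^ s * W)) V (u + s * v + v) v α β := by
      convert h using 1 <;> ring
    convert ih hstep.quotient using 1
    ring

end Iteration

/-! ### Critical extensions in the ring of germs -/

section GermRing

variable {σ : Type} [Fintype σ]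

/-- The value of a germ at the origin. -/
noncomputable def germValue : analyticGerms σ →+* ℂ :=
  (Filter.Germ.valueRingHom (x := (0 : σ → ℂ))).comp (analyticGerms σ).subtype

theorem isUnit_of_germValue_ne_zero {g : analyticGerms σ} (hg : germValue g ≠ 0) : IsUnit g := by
  obtain ⟨_, f, hf, rfl⟩ := g
  have hf0 : f 0 ≠ 0 := hg
  refine IsUnit.of_mul_eq_one ⟨(f⁻¹ : (σ → ℂ) → ℂ), f⁻¹, hf.inv hf0, rfl⟩ (Subtype.ext ?_)
  refine Filter.Germ.coe_eq.2 ?_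
  filter_upwards [hf.continuousAt.eventually_ne hf0] with x hx
  exact mul_inv_cancel₀ hx

instance isLocalHom_germValue : IsLocalHom (germValue (σ := σ)) :=
  ⟨fun _ hg => isUnit_of_germValue_ne_zero hg.ne_zero⟩

instance isLocalRing_analyticGerms : IsLocalRing (analyticGerms σ) :=
  RingHom.domain_isLocalRing germValue

/-- Taking germs of polynomials, as a ring homomorphism. -/
noncomputable def polyGermHom : MvPolynomial σ ℂ →+* analyticGerms σ where
  toFun := polyGerm
  map_one' :=
    Subtype.ext (Filter.Germ.coe_eq.2 (.of_forall fun x => map_one (MvPolynomial.eval x)))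
  map_zero' :=
    Subtype.ext (Filter.Germ.coe_eq.2 (.of_forall fun x => map_zero (MvPolynomial.eval x)))
  map_add' p q :=
    Subtype.ext (Filter.Germ.coe_eq.2 (.of_forall fun x => map_add (MvPolynomial.eval x) p q))
  map_mul' p q :=
    Subtype.ext (Filter.Germ.coe_eq.2 (.of_forall fun x => map_mul (MvPolynomial.eval x) p q))

noncomputable instance algebraRat_analyticGerms : Algebra ℚ (analyticGerms σ) :=
  ((polyGermHom.comp MvPolynomial.C).comp (algebraMap ℚ ℂ)).toAlgebra

theorem residue_polyGermHom_X (i : σ) :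
    IsLocalRing.residue (analyticGerms σ) (polyGermHom (MvPolynomial.X i)) = 0 := by
  rw [IsLocalRing.residue_eq_zero_iff, IsLocalRing.mem_maximalIdeal, mem_nonunits_iff]
  refine fun hu => (hu.map germValue).ne_zero ?_
  change MvPolynomial.eval (0 : σ → ℂ) (MvPolynomial.X i) = 0
  rw [MvPolynomial.eval_X, Pi.zero_apply]

variable [DecidableEq σ]

theorem partialDeriv_add (i : σ) (f g : analyticGerms σ) :
    partialDeriv i (f + g) = partialDeriv i f + partialDeriv i g := by
  obtain ⟨_, f, hf, rfl⟩ := f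
  obtain ⟨_, g, hg, rfl⟩ := g
  refine Subtype.ext (Filter.Germ.coe_eq.2 ?_)
  filter_upwards [hf.eventually_analyticAt, hg.eventually_analyticAt] with x hx hy
  change fderiv ℂ (f + g) x (Pi.single i 1) = _
  rw [fderiv_add hx.differentiableAt hy.differentiableAt]
  rfl

theorem partialDeriv_mul (i : σ) (f g : analyticGerms σ) :
    partialDeriv i (f * g) = f • partialDeriv i g + g • partialDeriv i f := by
  obtain ⟨_, f, hf, rfl⟩ := f
  obtain ⟨_, g, hg, rfl⟩ := g
  refine Subtype.ext (Filter.Germ.coe_eq.2 ?_)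
  filter_upwards [hf.eventually_analyticAt, hg.eventually_analyticAt] with x hx hy
  change fderiv ℂ (f * g) x (Pi.single i 1) = _
  rw [fderiv_mul hx.differentiableAt hy.differentiableAt]
  rfl

/-- The partial derivatives of germs as derivations. -/
noncomputable def germDerivation (i : σ) : Derivation ℤ (analyticGerms σ) (analyticGerms σ) :=
  Derivation.mk' (AddMonoidHom.mk' (partialDeriv i) (partialDeriv_add i)).toIntLinearMap
    (partialDeriv_mul i)

theorem germDerivation_polyGermHom_X (i k : σ) :
    germDerivation i (polyGermHom (MvPolynomial.X k)) = if i = k then 1 else 0 := by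
  have h (x : σ → ℂ) : fderiv ℂ (fun x : σ → ℂ => MvPolynomial.eval x (MvPolynomial.X k)) x
      (Pi.single i 1) = if i = k then 1 else 0 := by
    simp only [MvPolynomial.eval_X]
    rw [(hasFDerivAt_apply k x).fderiv]
    simp [Pi.single_apply, eq_comm]
  refine Subtype.ext ((Filter.Germ.coe_eq.2 (Filter.Eventually.of_forall h)).trans ?_)
  split_ifs <;> rfl

end GermRing

section CriticalChain

variable {σ : Type} [Fintype σ] [DecidableEq σ]

theorem criticalChain_add (J : Ideal (analyticGerms σ)) (m s : ℕ) :
    criticalChain J (m + s) = criticalChain (criticalChain J m) s := by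
  induction s with
  | zero => rfl
  | succ s ih => rw [← add_assoc, criticalChain, ih, criticalChain]

theorem map_tbSymbol_range_add (J : Ideal (analyticGerms σ)) (m s : ℕ) :
    (List.range (m + s)).map (tbSymbol J) =
      (List.range m).map (tbSymbol J) ++ (List.range s).map (tbSymbol (criticalChain J m)) := by
  rw [List.range_add, List.map_append, List.map_map]
  congr 2
  funext k
  rw [Function.comp_apply, tbSymbol, tbSymbol, criticalChain_add]

variable {V W : (analyticGerms σ)⟦X⟧} {u v α β s : ℕ}

theorem upperExtension_pairIdeal (h : IsCoordinatePair germDerivation (V * W) V (u + v) v α β) :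
    upperExtension v (pairIdeal (V * W) V (u + v) v α β) = pairIdeal W V u v α (α + β) :=
  h.jacExt_eq (Nat.sub_add_cancel (h.le_card.trans (Nat.le_succ _)))

theorem criticalIndex_pairIdeal (h : IsCoordinatePair germDerivation (V * W) V (u + v) v α β) :
    criticalIndex (pairIdeal (V * W) V (u + v) v α β) = v := by
  have hk : sInf {k | jacobianExtension k (pairIdeal (V * W) V (u + v) v α β) ≠ ⊤} =
    Fintype.card σ + 1 - v := h.sInf_eq
  rw [criticalIndex, hk, Nat.sub_sub_self (h.le_card.trans (Nat.le_succ _))]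

theorem criticalChain_pairIdeal
    (h : IsCoordinatePair germDerivation (V ^ s * W) V (u + s * v) v α β) :
    criticalChain (pairIdeal (V ^ s * W) V (u + s * v) v α β) s =
      pairIdeal W V u v α (s * α + β) := by
  induction s generalizing β with
  | zero => simp [criticalChain]
  | succ s ih =>
    rw [pow_succ', mul_assoc, add_one_mul s v, ← add_assoc] at h ⊢
    rw [add_comm s, criticalChain_add, criticalChain, criticalChain, criticalIndex_pairIdeal h,
      upperExtension_pairIdeal h, ih h.quotient]
    congr 1
    ring

theorem iterate_upperExtension_pairIdeal
    (h : IsCoordinatePair germDerivation (V ^ s * W) V (u + s * v) v α β) :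
    (upperExtension v)^[s] (pairIdeal (V ^ s * W) V (u + s * v) v α β) =
      pairIdeal W V u v α (s * α + β) := by
  induction s generalizing β with
  | zero => simp
  | succ s ih =>
    rw [pow_succ', mul_assoc, add_one_mul s v, ← add_assoc] at h ⊢
    rw [Function.iterate_succ_apply, upperExtension_pairIdeal h, ih h.quotient]
    congr 1
    ring

theorem map_tbSymbol_pairIdeal
    (h : IsCoordinatePair germDerivation (V ^ s * W) V (u + s * v) v α β) :
    (List.range s).map (tbSymbol (pairIdeal (V ^ s * W) V (u + s * v) v α β)) =
      List.replicate s v := by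
  induction s generalizing β with
  | zero => rfl
  | succ s ih =>
    rw [pow_succ', mul_assoc, add_one_mul s v, ← add_assoc] at h ⊢
    have hfirst : (List.range 1).map
        (tbSymbol (pairIdeal (V * (V ^ s * W)) V (u + s * v + v) v α β)) = [v] :=
      congrArg (fun i => [i]) (criticalIndex_pairIdeal h)
    rw [add_comm s, map_tbSymbol_range_add, hfirst, criticalChain, criticalChain,
      criticalIndex_pairIdeal h, upperExtension_pairIdeal h, ih h.quotient, add_comm,
      List.replicate_succ, List.singleton_append]

end CriticalChain

/-! ### The multiplication map -/

section Multiplication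

universe w

theorem isCoordinatePair_monicSeries {A : Type w} [CommRing A] [IsLocalRing A] {n r α β : ℕ}
    {D : Fin n ⊕ Fin r → Derivation ℤ A A} {a : Fin n ⊕ Fin r → A}
    (ha : ∀ k, IsLocalRing.residue A (a k) = 0)
    (hD : ∀ i k, D i (a k) = if i = k then 1 else 0) (hα : α ≠ 0) (hβ : β ≠ 0) :
    IsCoordinatePair D (monicSeries (a ∘ Sum.inl)) (monicSeries (a ∘ Sum.inr)) n r α β where
  constantCoeff_left := constantCoeff_monicSeries _
  constantCoeff_right := constantCoeff_monicSeries _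
  map_residue_left := by simp [monicSeries, ha]
  map_residue_right := by simp [monicSeries, ha]
  left_ne_zero := hα
  right_ne_zero := hβ
  existsUnique_tangent S _ _ _ U' hU' V' hV' hU0 hV0 := by
    have hjac : jacobian D a = 1 := by
      ext i j
      exact (hD j i).trans (by simp only [Matrix.one_apply, eq_comm])
    have htangent (x : Fin n ⊕ Fin r → S) (k) : tangent D x (a k) = x k := by
      rw [tangent_apply, hjac, Matrix.map_one _ (map_zero _) (map_one _), Matrix.one_mulVec]
    refine ⟨Sum.elim (fun i => coeff (n - i : ℕ) U') fun i => coeff (r - i : ℕ) V', ?_, ?_⟩ <;>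
      simp only [coeffwise_monicSeries_eq_iff _ _ hU' hU0, coeffwise_monicSeries_eq_iff _ _ hV' hV0,
        Function.comp_apply, htangent]
    · exact ⟨fun _ => rfl, fun _ => rfl⟩
    · rintro x ⟨hxU, hxV⟩
      funext k
      cases k with
      | inl i => exact hxU i
      | inr i => exact hxV i

theorem natDegree_monic_le {S : Type*} [CommRing S] {d : ℕ} (c : Fin d → S) :
    (Polynomial.X ^ d + ∑ i : Fin d, Polynomial.C (c i) * Polynomial.X ^ (i : ℕ)).natDegree ≤
      d := by
  refine Polynomial.natDegree_add_le_of_degree_le (Polynomial.natDegree_X_pow_le d)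
    (Polynomial.natDegree_sum_le_of_forall_le _ _ fun i _ => ?_)
  exact (Polynomial.natDegree_C_mul_X_pow_le _ _).trans i.2.le

theorem coe_reflect_monic {S : Type*} [CommRing S] {d : ℕ} (c : Fin d → S) :
    ((Polynomial.X ^ d + ∑ i : Fin d, Polynomial.C (c i) * Polynomial.X ^ (i : ℕ)).reflect d :
      S⟦X⟧) = monicSeries c := by
  have hsum := map_sum
    (AddMonoidHom.mk' (Polynomial.reflect d) fun f g : Polynomial S => Polynomial.reflect_add f g d)
    (fun i : Fin d => Polynomial.C (c i) * Polynomial.X ^ (i : ℕ)) Finset.univ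
  simp only [AddMonoidHom.mk'_apply, Polynomial.reflect_C_mul_X_pow] at hsum
  rw [Polynomial.reflect_add, hsum, Polynomial.reflect_monomial, Polynomial.revAt_le le_rfl,
    Nat.sub_self, pow_zero, ← Polynomial.coeToPowerSeries.ringHom_apply, map_add, map_one, map_sum,
    monicSeries]
  congr 1
  refine Finset.sum_congr rfl fun i _ => ?_
  simp [Polynomial.revAt_le i.2.le]

variable (n r : ℕ)

theorem coeff_seriesA_mul_seriesB {j : ℕ} (hj : j ≤ n + r) :
    coeff j (seriesA n r * seriesB n r) = (genericF n r * genericG n r).coeff (n + r - j) := by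
  have hreflect : seriesA n r * seriesB n r =
      ((genericF n r * genericG n r).reflect (n + r) : Polynomial (CoeffPoly n r)) := by
    rw [genericF, genericG, Polynomial.reflect_mul _ _ (natDegree_monic_le _)
      (natDegree_monic_le _), Polynomial.coe_mul, coe_reflect_monic, coe_reflect_monic]
    rfl
  rw [hreflect, Polynomial.coeff_coe, Polynomial.coeff_reflect, Polynomial.revAt_le hj]

/-- The germ of the series `A(t)`. -/
noncomputable def germA : (analyticGerms (Fin n ⊕ Fin r))⟦X⟧ :=
  monicSeries fun i => polyGermHom (MvPolynomial.X (Sum.inl i))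

/-- The germ of the series `B(t)`. -/
noncomputable def germB : (analyticGerms (Fin n ⊕ Fin r))⟦X⟧ :=
  monicSeries fun i => polyGermHom (MvPolynomial.X (Sum.inr i))

theorem map_seriesA : PowerSeries.map polyGermHom (seriesA n r) = germA n r :=
  map_monicSeries polyGermHom fun i => MvPolynomial.X (Sum.inl i)

theorem map_seriesB : PowerSeries.map polyGermHom (seriesB n r) = germB n r :=
  map_monicSeries polyGermHom fun i => MvPolynomial.X (Sum.inr i)

theorem isCoordinatePair_germA_germB :
    IsCoordinatePair germDerivation (germA n r) (germB n r) n r 1 1 :=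
  isCoordinatePair_monicSeries (a := fun k => polyGermHom (MvPolynomial.X k))
    residue_polyGermHom_X germDerivation_polyGermHom_X one_ne_zero one_ne_zero

theorem multIdeal_eq_pairIdeal : multIdeal n r = pairIdeal (germA n r) (germB n r) n r 1 1 := by
  refine eq_of_forall_ge_iff fun K => ?_
  have hcoeff (j : Fin (n + r)) :
      coeff (n + r - j : ℕ) (PowerSeries.map (Ideal.Quotient.mk K) (germA n r * germB n r)) =
        Ideal.Quotient.mk K (polyGerm ((genericF n r * genericG n r).coeff j)) := by
    rw [← map_seriesA, ← map_seriesB, ← map_mul, coeff_map, coeff_map,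
      coeff_seriesA_mul_seriesB n r (Nat.sub_le _ _), Nat.sub_sub_self j.2.le]
    rfl
  have hA := monicSeries_mem_degreeLE
    (Ideal.Quotient.mk K ∘ fun i => polyGermHom (MvPolynomial.X (Sum.inl i)))
  have hB := monicSeries_mem_degreeLE
    (Ideal.Quotient.mk K ∘ fun i => polyGermHom (MvPolynomial.X (Sum.inr i)))
  rw [← map_monicSeries] at hA hB
  trans PowerSeries.map (Ideal.Quotient.mk K) (germA n r * germB n r) = 1
  · rw [multIdeal, Ideal.span_le]
    constructor
    · intro hK
      refine eq_of_mem_degreeLE (by rw [map_mul]; exact mul_mem_degreeLE hA hB)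
        (one_mem_degreeLE _) ?_ fun j => ?_
      · rw [map_one, constantCoeff_map_eq_one]
        rw [map_mul, germA, germB, constantCoeff_monicSeries, constantCoeff_monicSeries, one_mul]
      · rw [hcoeff, Ideal.Quotient.eq_zero_iff_mem.2 (hK ⟨j, j.2, rfl⟩), coeff_one,
          if_neg (by omega)]
    · rintro hone _ ⟨j, hj, rfl⟩
      refine Ideal.Quotient.eq_zero_iff_mem.1 ((hcoeff ⟨j, hj⟩).symm.trans ?_)
      rw [hone, coeff_one, if_neg (by simp only; omega)]
  · conv_rhs => rw [← Ideal.mk_ker (I := K), pairIdeal_le_ker_iff, pow_one, pow_one, ← map_mul]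
    exact ⟨fun h => ⟨hA, hB, h⟩, fun h => h.2.2⟩

end Multiplication

/-! ### The polynomials `ψ_k` -/

section Psi

variable (n r : ℕ)

theorem seriesB_mul_invB : seriesB n r * invB n r = 1 :=
  mul_invOfUnit _ 1 (constantCoeff_monicSeries _)

variable {n r : ℕ}

/-- The partial derivative with respect to the coefficient `b_j`. -/
noncomputable def pderivB (j : Fin r) : Derivation ℤ (CoeffPoly n r) (CoeffPoly n r) :=
  (MvPolynomial.pderiv (Sum.inr j)).restrictScalars ℤ

theorem coeffwise_pderivB_seriesA (j : Fin r) : coeffwise (pderivB j) (seriesA n r) = 0 :=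
  (coeffwise_monicSeries_eq_iff _ _ (zero_mem _) (map_zero _)).2 fun i =>
    (MvPolynomial.pderiv_X_of_ne (by simp)).trans (map_zero _).symm

theorem coeffwise_pderivB_seriesB (j : Fin r) :
    coeffwise (pderivB j) (seriesB n r) = X ^ (r - j : ℕ) := by
  refine (coeffwise_monicSeries_eq_iff _ _ (X_pow_mem_degreeLE (Nat.sub_le _ _)) ?_).2 fun i => ?_
  · rw [map_pow, constantCoeff_X, zero_pow (by omega)]
  · refine (MvPolynomial.pderiv_X _ _).trans ?_
    rw [coeff_X_pow, Pi.single_apply]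
    refine if_congr ?_ rfl rfl
    rw [Sum.inr.injEq, Fin.ext_iff]
    omega

theorem coeffwise_inv_pow_mul {A : Type*} [CommRing A] {δ : Derivation ℤ A A} {F G I Y : A⟦X⟧}
    (hF : coeffwise δ F = 0) (hG : coeffwise δ G = Y) (hGI : G * I = 1) (k : ℕ) :
    coeffwise δ (I ^ k * F) = -k * (Y * (I ^ (k + 1) * F)) := by
  have hI : coeffwise δ I = -(I ^ 2 * Y) := by
    have h := coeffwise_mul δ G I
    rw [hGI, Derivation.map_one_eq_zero, hG] at h
    simp only [Algebra.algebraMap_self, PowerSeries.map_id, id_eq] at h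
    linear_combination -I * h - coeffwise δ I * hGI
  rw [coeffwise_mul, hF, coeffwise_pow, hI]
  simp only [Algebra.algebraMap_self, PowerSeries.map_id, id_eq]
  rcases k with _ | k
  · simp
  · rw [Nat.add_sub_cancel]
    ring

theorem pderiv_coeff_invB_pow_mul_seriesA (j : Fin r) (k : ℕ) {m : ℕ} (hm : r - j ≤ m) :
    MvPolynomial.pderiv (Sum.inr j) (coeff m (invB n r ^ k * seriesA n r)) =
      MvPolynomial.C (-k : ℂ) * coeff (m - (r - j)) (invB n r ^ (k + 1) * seriesA n r) := by
  have h := coeffwise_inv_pow_mul (coeffwise_pderivB_seriesA (n := n) j)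
    (coeffwise_pderivB_seriesB j) (seriesB_mul_invB n r) k
  refine (coeff_coeffwise (pderivB j) _ m).symm.trans ((congrArg (coeff m) h).trans ?_)
  rw [← map_natCast (C (R := CoeffPoly n r)), ← map_neg, coeff_C_mul, coeff_X_pow_mul', if_pos hm,
    map_neg, map_natCast]

open Nat in
theorem psiBlock_eq (s : ℕ) (i : Fin r) (hs : (s + 1) * r ≤ n) :
    psiBlock n r s i = MvPolynomial.C ((-1 : ℂ) ^ s * s !) *
      coeff (n - (s * r + i)) (invB n r ^ (s + 1) * seriesA n r) := by
  have hi := i.2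
  rcases s with _ | s
  · simp [psiBlock, dPoly, seriesD]
  · induction s with
    | zero =>
      have h := pderiv_coeff_invB_pow_mul_seriesA (n := n) i.rev 1 (m := n - (r - 1))
        (by rw [Fin.val_rev]; omega)
      rw [pow_one] at h
      rw [psiBlock, Function.iterate_zero_apply, dPoly, seriesD, h]
      simp only [Fin.val_rev, zero_add, pow_one, Nat.factorial_one, Nat.cast_one, mul_one]
      congr 3
      omega
    | succ s ih =>
      simp only [add_mul, one_mul] at hs ih
      have hstep : psiBlock n r (s + 1 + 1) i =
          MvPolynomial.pderiv (Sum.inr ⟨0, i.pos⟩) (psiBlock n r (s + 1) i) := by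
        rw [psiBlock, psiBlock, Function.iterate_succ_apply']
      have hconst : (-1 : ℂ) ^ (s + 1) * (s + 1) ! * -(s + 1 + 1 : ℕ) =
          (-1) ^ (s + 1 + 1) * (s + 1 + 1) ! := by
        rw [Nat.factorial_succ (s + 1), Nat.cast_mul]
        ring
      have hidx : n - (s * r + r + i) - (r - (⟨0, i.pos⟩ : Fin r)) = n - (s * r + r + r + i) := by
        simp only
        omega
      rw [hstep, ih (by omega), MvPolynomial.pderiv_C_mul, pderiv_coeff_invB_pow_mul_seriesA _ _
        (by simp only; omega), hidx, ← mul_assoc, ← map_mul, hconst,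
        add_mul, add_mul, one_mul]

theorem associated_psi {k : ℕ} (hk : k < n / r * r) :
    Associated (psi n r k) (coeff (n - k) (invB n r ^ (k / r + 1) * seriesA n r)) := by
  have hr : 0 < r := Nat.pos_of_mul_pos_left ((Nat.zero_le k).trans_lt hk)
  have hkr : (k / r + 1) * r ≤ n :=
    (Nat.mul_le_mul_right r (Nat.div_lt_of_lt_mul (mul_comm r _ ▸ hk))).trans
      (Nat.div_mul_le_self n r)
  rw [psi, dif_pos hr, if_pos hk, psiBlock_eq _ _ hkr, Nat.div_add_mod']
  refine associated_unit_mul_left _ _ (IsUnit.map _ (IsUnit.mk0 _ ?_))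
  exact mul_ne_zero (pow_ne_zero _ (neg_ne_zero.2 one_ne_zero))
    (Nat.cast_ne_zero.2 (Nat.factorial_ne_zero _))

variable {S : Type*} [CommRing S] (π : CoeffPoly n r →+* S) {W Q : S⟦X⟧}

theorem map_seriesB_mul_map_invB :
    PowerSeries.map π (seriesB n r) * PowerSeries.map π (invB n r) = 1 := by
  rw [← map_mul, seriesB_mul_invB, map_one]

theorem associated_map_psi {s k : ℕ} (hs : s * r ≤ n) (hk : k < s * r)
    (hW : PowerSeries.map π (seriesB n r) ^ s * W = PowerSeries.map π (seriesA n r)) :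
    Associated (π (psi n r k))
      (coeff (n - k) (PowerSeries.map π (seriesB n r) ^ (s - (k / r + 1)) * W)) := by
  have hr : 0 < r := Nat.pos_of_mul_pos_left ((Nat.zero_le k).trans_lt hk)
  have hkn : k < n / r * r := hk.trans_le (Nat.mul_le_mul_right r ((Nat.le_div_iff_mul_le hr).2 hs))
  convert (associated_psi hkn).map π using 1
  have hks : k / r + 1 ≤ s := Nat.div_lt_of_lt_mul (mul_comm s r ▸ hk)
  have hinv : PowerSeries.map π (seriesB n r) ^ (k / r + 1) *
      PowerSeries.map π (invB n r) ^ (k / r + 1) = 1 := by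
    rw [← mul_pow, map_seriesB_mul_map_invB, one_pow]
  rw [← coeff_map, map_mul (PowerSeries.map π), map_pow, ← hW]
  nth_rewrite 2 [← Nat.sub_add_cancel hks]
  rw [pow_add]
  congr 1
  linear_combination -(PowerSeries.map π (seriesB n r) ^ (s - (k / r + 1)) * W) * hinv

theorem map_psi_div_mul_add (hnr : 0 < n / r) (i : ℕ)
    (hW : PowerSeries.map π (seriesB n r) ^ (n / r) * W = PowerSeries.map π (seriesA n r))
    (hQ : PowerSeries.map π (seriesB n r) = W * Q) :
    π (psi n r (n / r * r + i)) = coeff (r - i) Q := by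
  have hr : 0 < r := Nat.pos_of_ne_zero fun h => by simp [h] at hnr
  have hidx : n - ((n / r - 1) * r + n % r + i) = r - i := by
    obtain ⟨q, hq⟩ := Nat.exists_eq_add_of_lt hnr
    have hdm := Nat.div_add_mod' n r
    rw [hq, zero_add, add_one_mul] at hdm
    rw [hq, zero_add, Nat.add_sub_cancel]
    omega
  have hconst : constantCoeff (invB n r ^ (n / r) * seriesD n r) = 1 := by
    have hA : constantCoeff (seriesA n r) = 1 := constantCoeff_monicSeries _
    simp [invB, seriesD, hA]
  have hinv := map_seriesB_mul_map_invB π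
  rw [psi, dif_pos hr, if_neg (by omega), Nat.add_sub_cancel_left, betaPoly, hidx, ← coeff_map]
  congr 1
  refine left_inv_eq_right_inv (a := PowerSeries.map π (invB n r ^ (n / r) * seriesD n r)) ?_ ?_
  · rw [← map_mul, mul_comm, mul_invOfUnit _ 1 hconst, map_one]
  · rw [seriesD, map_mul, map_mul, map_pow, ← hW]
    have hinv' : PowerSeries.map π (invB n r) ^ (n / r) *
        PowerSeries.map π (seriesB n r) ^ (n / r) = 1 := by
      rw [← mul_pow, mul_comm, hinv, one_pow]
    linear_combination hinv' * (PowerSeries.map π (invB n r) * W * Q) -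
      PowerSeries.map π (invB n r) * hQ + hinv

end Psi

/-! ### Two divisions with remainder -/

section Euclid

theorem sup_span_image_congr {A ι : Type*} [CommRing A] {J : Ideal A} {T : Set ι} {f g : ι → A}
    (h : ∀ k ∈ T, Associated (Ideal.Quotient.mk J (f k)) (Ideal.Quotient.mk J (g k))) :
    J ⊔ Ideal.span (f '' T) = J ⊔ Ideal.span (g '' T) := by
  refine eq_of_forall_ge_iff fun K => ?_
  rw [sup_le_iff, sup_le_iff, Ideal.span_le, Ideal.span_le, Set.image_subset_iff,
    Set.image_subset_iff]
  refine and_congr_right fun hJK => forall₂_congr fun k hk => ?_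
  have hK := ((h k hk).map (Ideal.Quotient.factor hJK)).eq_zero_iff
  rwa [Ideal.Quotient.factor_mk, Ideal.Quotient.factor_mk, Ideal.Quotient.eq_zero_iff_mem,
    Ideal.Quotient.eq_zero_iff_mem] at hK

theorem pairIdeal_sup_span_psi {A : Type*} [CommRing A] {U V W : A⟦X⟧} {n r u s α β : ℕ}
    {g : ℕ → A} (hV : constantCoeff V = 1) (hU : V ^ s * W = U) (hn : u + s * r = n)
    {π : CoeffPoly n r →+* A ⧸ pairIdeal U V n r α β}
    (hπA : PowerSeries.map π (seriesA n r) = PowerSeries.map (Ideal.Quotient.mk _) U)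
    (hπB : PowerSeries.map π (seriesB n r) = PowerSeries.map (Ideal.Quotient.mk _) V)
    (hg : ∀ k, Ideal.Quotient.mk _ (g k) = π (psi n r k)) :
    pairIdeal U V n r α β ⊔ Ideal.span (g '' Set.Iio (s * r)) =
      pairIdeal W V u r α (s * α + β) := by
  subst hU hn
  rw [← pairIdeal_pow_mul_sup_span hV]
  refine sup_span_image_congr fun k hk => ?_
  rw [hg, ← coeff_map, map_mul, map_pow, ← hπB]
  refine associated_map_psi π (Nat.le_add_left _ _) hk ?_
  rw [hπA, hπB, map_mul, map_pow]

variable (n r : ℕ)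

/-- The germ of the series `P = B ^ (-q) * A`, where `q` is the quotient of `n` by `r`; its
coefficients are the germs of the polynomials `γ_i`. -/
noncomputable def germP : (analyticGerms (Fin n ⊕ Fin r))⟦X⟧ :=
  PowerSeries.map polyGermHom (invB n r ^ (n / r) * seriesA n r)

theorem germB_pow_mul_germP : germB n r ^ (n / r) * germP n r = germA n r := by
  rw [germP, ← map_seriesA, ← map_seriesB, ← map_pow, ← map_mul, ← mul_assoc, ← mul_pow,
    seriesB_mul_invB, one_pow, one_mul]

/-- The ideal `I(μ_{n,r}) + (ψ_0, …, ψ_{qr-1})`, where `q` is the quotient of `n` by `r`, as the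
ideal of the pair consisting of `B` and `P`; see `multIdeal_sup_span_psi`. -/
noncomputable def psiIdeal : Ideal (analyticGerms (Fin n ⊕ Fin r)) :=
  pairIdeal (germB n r) (germP n r) r (n % r) (n / r + 1) 1

theorem isCoordinatePair_germB_pow_mul_germP :
    IsCoordinatePair germDerivation (germB n r ^ (n / r) * germP n r) (germB n r)
      (n % r + n / r * r) r 1 1 := by
  rw [germB_pow_mul_germP, Nat.mod_add_div']
  exact isCoordinatePair_germA_germB n r

theorem isCoordinatePair_germB_germP :
    IsCoordinatePair germDerivation (germB n r) (germP n r) r (n % r) (n / r + 1) 1 := by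
  have h := (isCoordinatePair_germB_pow_mul_germP n r).quotient_pow.symm
  rwa [mul_one] at h

theorem psiIdeal_eq :
    psiIdeal n r = pairIdeal (germP n r) (germB n r) (n % r) r 1 (n / r * 1 + 1) := by
  rw [psiIdeal, pairIdeal_comm, mul_one]

theorem multIdeal_eq_pairIdeal_pow_mul :
    multIdeal n r =
      pairIdeal (germB n r ^ (n / r) * germP n r) (germB n r) (n % r + n / r * r) r 1 1 := by
  rw [multIdeal_eq_pairIdeal, germB_pow_mul_germP, Nat.mod_add_div']

theorem multIdeal_sup_span_psi :
    multIdeal n r ⊔ Ideal.span ((fun k => polyGerm (psi n r k)) '' Set.Iio (n / r * r)) =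
      psiIdeal n r := by
  rw [multIdeal_eq_pairIdeal, psiIdeal_eq]
  refine pairIdeal_sup_span_psi (π := (Ideal.Quotient.mk _).comp polyGermHom)
    (constantCoeff_monicSeries _) (germB_pow_mul_germP n r) (Nat.mod_add_div' n r) ?_ ?_
    fun k => rfl
  · rw [← map_seriesA]
    rfl
  · rw [← map_seriesB]
    rfl

theorem iterate_upperExtension_multIdeal :
    (upperExtension r)^[n / r] (multIdeal n r) = psiIdeal n r := by
  rw [multIdeal_eq_pairIdeal_pow_mul, psiIdeal_eq,
    iterate_upperExtension_pairIdeal (isCoordinatePair_germB_pow_mul_germP n r)]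

theorem criticalChain_multIdeal : criticalChain (multIdeal n r) (n / r) = psiIdeal n r := by
  rw [multIdeal_eq_pairIdeal_pow_mul, psiIdeal_eq,
    criticalChain_pairIdeal (isCoordinatePair_germB_pow_mul_germP n r)]

/-- The substitution of the coefficients of `B` and `P` for the variables, which turns the
polynomials `ψ_k` attached to `(r, n % r)` into the polynomials `φ_k`. -/
noncomputable def phiSubst : CoeffPoly r (n % r) →+* CoeffPoly n r :=
  MvPolynomial.aeval
    (Sum.elim (fun j : Fin r => (MvPolynomial.X (Sum.inr j) : CoeffPoly n r))
      (fun j : Fin (n % r) => gammaPoly n r (n - n % r + (j : ℕ)))) |>.toRingHom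

/-- The substitution `phiSubst` followed by the reduction modulo `psiIdeal n r`. -/
noncomputable def phiReduction :
    CoeffPoly r (n % r) →+* analyticGerms (Fin n ⊕ Fin r) ⧸ psiIdeal n r :=
  ((Ideal.Quotient.mk (psiIdeal n r)).comp polyGermHom).comp (phiSubst n r)

variable {n r}

theorem mk_polyGerm_phi (k : ℕ) : Ideal.Quotient.mk (psiIdeal n r) (polyGerm (phi n r k)) =
    phiReduction n r (psi r (n % r) k) :=
  rfl

theorem map_phiReduction_seriesA : PowerSeries.map (phiReduction n r) (seriesA r (n % r)) =
    PowerSeries.map (Ideal.Quotient.mk (psiIdeal n r)) (germB n r) := by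
  have h : phiReduction n r ∘ (fun j => MvPolynomial.X (Sum.inl j)) =
      Ideal.Quotient.mk (psiIdeal n r) ∘ fun j => polyGermHom (MvPolynomial.X (Sum.inr j)) := by
    funext j
    simp [phiReduction, phiSubst]
  rw [germB, map_monicSeries, ← h]
  exact map_monicSeries (phiReduction n r) _

/-- Modulo `psiIdeal n r` the series `P` is a polynomial of degree at most `n % r`, hence
determined by the coefficients which `phiSubst` substitutes. -/
theorem map_phiReduction_seriesB : PowerSeries.map (phiReduction n r) (seriesB r (n % r)) =
    PowerSeries.map (Ideal.Quotient.mk (psiIdeal n r)) (germP n r) := by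
  have hP : PowerSeries.map (Ideal.Quotient.mk (psiIdeal n r)) (germP n r) ∈
      degreeLE _ (n % r) := (pairIdeal_le_ker_iff.1 (Ideal.mk_ker (I := psiIdeal n r)).ge).2.1
  refine (eq_of_mem_degreeLE hP ?_ ?_ fun i => ?_).symm
  · exact (map_monicSeries (phiReduction n r) _).symm ▸ monicSeries_mem_degreeLE _
  · rw [constantCoeff_map_eq_one (isCoordinatePair_germB_germP n r).constantCoeff_right]
    exact (constantCoeff_map_eq_one (constantCoeff_monicSeries _) _).symm
  · have hidx : n - (n - n % r + (i : ℕ)) = n % r - i := by have := Nat.mod_le n r; omega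
    have hcoeff : coeff (n % r - i : ℕ) (seriesB r (n % r)) = MvPolynomial.X (Sum.inr i) :=
      coeff_monicSeries _ i
    rw [coeff_map, coeff_map, hcoeff, germP, coeff_map, ← hidx]
    simp [phiReduction, phiSubst, gammaPoly]

theorem extendedIdeal_eq_sup (u v : ℕ) :
    extendedIdeal n r u v =
      multIdeal n r ⊔ Ideal.span ((fun k => polyGerm (psi n r k)) '' Set.Iio u) ⊔
        Ideal.span ((fun k => polyGerm (phi n r k)) '' Set.Iio v) := by
  have himage (f : ℕ → analyticGerms (Fin n ⊕ Fin r)) (w : ℕ) :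
      {h | ∃ k < w, h = f k} = f '' Set.Iio w := by
    ext
    simp [eq_comm]
  rw [extendedIdeal, himage, himage, Ideal.span_union, sup_assoc]

theorem extendedIdeal_eq_psiIdeal_sup (v : ℕ) :
    extendedIdeal n r (n / r * r) v =
      psiIdeal n r ⊔ Ideal.span ((fun k => polyGerm (phi n r k)) '' Set.Iio v) := by
  rw [extendedIdeal_eq_sup, multIdeal_sup_span_psi]

variable {u s : ℕ} {W : (analyticGerms (Fin n ⊕ Fin r))⟦X⟧}

theorem extendedIdeal_eq_pairIdeal (hW : germP n r ^ s * W = germB n r)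
    (hu : u + s * (n % r) = r) :
    extendedIdeal n r (n / r * r) (s * (n % r)) =
      pairIdeal W (germP n r) u (n % r) (n / r + 1) (s * (n / r + 1) + 1) := by
  rw [extendedIdeal_eq_psiIdeal_sup]
  exact pairIdeal_sup_span_psi (isCoordinatePair_germB_germP n r).constantCoeff_right hW hu
    map_phiReduction_seriesA map_phiReduction_seriesB mk_polyGerm_phi

theorem isCoordinatePair_germP_pow_mul (hW : germP n r ^ s * W = germB n r)
    (hu : u + s * (n % r) = r) :
    IsCoordinatePair germDerivation (germP n r ^ s * W) (germP n r) (u + s * (n % r)) (n % r)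
      (n / r + 1) 1 := by
  rw [hW, hu]
  exact isCoordinatePair_germB_germP n r

theorem psiIdeal_eq_pairIdeal_pow_mul (hW : germP n r ^ s * W = germB n r)
    (hu : u + s * (n % r) = r) :
    psiIdeal n r =
      pairIdeal (germP n r ^ s * W) (germP n r) (u + s * (n % r)) (n % r) (n / r + 1) 1 := by
  rw [hW, hu, psiIdeal]

variable (n r) in
theorem exists_germP_pow_mul_eq (s : ℕ) :
    ∃ W : (analyticGerms (Fin n ⊕ Fin r))⟦X⟧, germP n r ^ s * W = germB n r :=
  ((isUnit_of_constantCoeff_eq_one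
    (isCoordinatePair_germB_germP n r).constantCoeff_right).pow s).dvd.imp fun _ h => h.symm

theorem iterate_upperExtension_psiIdeal (hs : s * (n % r) ≤ r) :
    (upperExtension (n % r))^[s] (psiIdeal n r) =
      extendedIdeal n r (n / r * r) (s * (n % r)) := by
  obtain ⟨W, hW⟩ := exists_germP_pow_mul_eq n r s
  have hu := Nat.sub_add_cancel hs
  rw [extendedIdeal_eq_pairIdeal hW hu, psiIdeal_eq_pairIdeal_pow_mul hW hu,
    iterate_upperExtension_pairIdeal (isCoordinatePair_germP_pow_mul hW hu)]

theorem criticalChain_psiIdeal (hs : s * (n % r) ≤ r) :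
    criticalChain (psiIdeal n r) s = extendedIdeal n r (n / r * r) (s * (n % r)) := by
  obtain ⟨W, hW⟩ := exists_germP_pow_mul_eq n r s
  have hu := Nat.sub_add_cancel hs
  rw [extendedIdeal_eq_pairIdeal hW hu, psiIdeal_eq_pairIdeal_pow_mul hW hu,
    criticalChain_pairIdeal (isCoordinatePair_germP_pow_mul hW hu)]

variable (n r) in
theorem map_tbSymbol_multIdeal :
    (List.range (n / r)).map (tbSymbol (multIdeal n r)) = List.replicate (n / r) r := by
  rw [multIdeal_eq_pairIdeal_pow_mul,
    map_tbSymbol_pairIdeal (isCoordinatePair_germB_pow_mul_germP n r)]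

theorem map_tbSymbol_psiIdeal (hs : s * (n % r) ≤ r) :
    (List.range s).map (tbSymbol (psiIdeal n r)) = List.replicate s (n % r) := by
  obtain ⟨W, hW⟩ := exists_germP_pow_mul_eq n r s
  have hu := Nat.sub_add_cancel hs
  rw [psiIdeal_eq_pairIdeal_pow_mul hW hu,
    map_tbSymbol_pairIdeal (isCoordinatePair_germP_pow_mul hW hu)]

section Remainder

variable {Q R : (analyticGerms (Fin n ⊕ Fin r))⟦X⟧}

theorem constantCoeff_remainder (hR : germP n r ^ s * R = germB n r) : constantCoeff R = 1 := by
  have h := isCoordinatePair_germB_germP n r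
  simpa [← hR, h.constantCoeff_right] using h.constantCoeff_left

theorem isCoordinatePair_remainder (hm : 0 < n % r)
    (hR : germP n r ^ (r / (n % r)) * R = germB n r) (hQ : R * Q = germP n r) :
    IsCoordinatePair germDerivation (R * Q) R (n % r - r % (n % r) + r % (n % r)) (r % (n % r))
      (r / (n % r) * (n / r + 1) + 1) (n / r + 1) := by
  rw [Nat.sub_add_cancel (Nat.mod_lt r hm).le, hQ]
  exact (isCoordinatePair_germP_pow_mul hR (Nat.mod_add_div' r (n % r))).quotient_pow.symm

theorem extendedIdeal_eq_pairIdeal_remainder (hm : 0 < n % r)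
    (hR : germP n r ^ (r / (n % r)) * R = germB n r) (hQ : R * Q = germP n r) :
    extendedIdeal n r (n / r * r) (r / (n % r) * (n % r)) =
      pairIdeal (R * Q) R (n % r - r % (n % r) + r % (n % r)) (r % (n % r))
        (r / (n % r) * (n / r + 1) + 1) (n / r + 1) := by
  rw [Nat.sub_add_cancel (Nat.mod_lt r hm).le, hQ, pairIdeal_comm,
    extendedIdeal_eq_pairIdeal hR (Nat.mod_add_div' r (n % r))]

variable (n r) in
theorem exists_remainder : ∃ R Q : (analyticGerms (Fin n ⊕ Fin r))⟦X⟧,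
    germP n r ^ (r / (n % r)) * R = germB n r ∧ R * Q = germP n r := by
  obtain ⟨R, hR⟩ := exists_germP_pow_mul_eq n r (r / (n % r))
  obtain ⟨Q, hQ⟩ := (isUnit_of_constantCoeff_eq_one (constantCoeff_remainder hR)).dvd
    (a := germP n r)
  exact ⟨R, Q, hR, hQ.symm⟩

theorem psiIdeal_sup_span_phi_remainder (hr : 0 < r / (n % r))
    (hR : germP n r ^ (r / (n % r)) * R = germB n r) (hQ : R * Q = germP n r) (T : Set ℕ) :
    psiIdeal n r ⊔
        Ideal.span ((fun i => polyGerm (phi n r (r / (n % r) * (n % r) + i))) '' T) =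
      psiIdeal n r ⊔ Ideal.span ((fun i => coeff (n % r - i) Q) '' T) := by
  refine sup_span_image_congr fun i _ => ?_
  rw [mk_polyGerm_phi, map_psi_div_mul_add (phiReduction n r) hr i
    (W := PowerSeries.map (Ideal.Quotient.mk _) R) (Q := PowerSeries.map (Ideal.Quotient.mk _) Q),
    coeff_map]
  · rw [map_phiReduction_seriesA, map_phiReduction_seriesB, ← map_pow, ← map_mul, hR]
  · rw [map_phiReduction_seriesB, ← map_mul, hQ]

theorem upperExtension_extendedIdeal (hm : 0 < n % r) (hr : n % r ≤ r) :
    upperExtension (r % (n % r)) (extendedIdeal n r (n / r * r) (r / (n % r) * (n % r))) =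
      extendedIdeal n r (n / r * r) (r / (n % r) * (n % r) + r % (n % r)) := by
  obtain ⟨R, Q, hR, hQ⟩ := exists_remainder n r
  have hpair := isCoordinatePair_remainder hm hR hQ
  have hlt := (Nat.mod_lt r hm).le
  rw [extendedIdeal_eq_pairIdeal_remainder hm hR hQ, upperExtension_pairIdeal hpair,
    ← pairIdeal_mul_sup_span hpair.constantCoeff_right,
    ← extendedIdeal_eq_pairIdeal_remainder hm hR hQ, extendedIdeal_eq_psiIdeal_sup,
    extendedIdeal_eq_psiIdeal_sup, sup_right_comm, ← image_sub_Iio, Set.image_image,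
    Nat.sub_add_cancel hlt,
    ← psiIdeal_sup_span_phi_remainder (Nat.div_pos hr hm) hR hQ, sup_right_comm, sup_assoc,
    ← Ideal.span_union, ← Iio_union_image_add, Set.image_union, Set.image_image]
  simp only [add_comm]

theorem criticalIndex_extendedIdeal (hm : 0 < n % r) :
    criticalIndex (extendedIdeal n r (n / r * r) (r / (n % r) * (n % r))) = r % (n % r) := by
  obtain ⟨R, Q, hR, hQ⟩ := exists_remainder n r
  rw [extendedIdeal_eq_pairIdeal_remainder hm hR hQ,
    criticalIndex_pairIdeal (isCoordinatePair_remainder hm hR hQ)]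

end Remainder

end Euclid

end ThomBoardman

open ThomBoardman in
theorem theorem3p14_general {n r q₁ r₁ q₂ r₂ : ℕ} (hn : n = q₁ * r + r₁) (hr₁ : 0 < r₁)
    (hr₁r : r₁ < r) (hr : r = q₂ * r₁ + r₂) (hr₂ : r₂ < r₁) :
    (∀ s ≤ q₂, (upperExtension r₁)^[s] ((upperExtension r)^[q₁] (multIdeal n r)) =
      extendedIdeal n r (q₁ * r) (s * r₁)) ∧
    upperExtension r₂ ((upperExtension r₁)^[q₂] ((upperExtension r)^[q₁] (multIdeal n r))) =
      extendedIdeal n r (q₁ * r) (q₂ * r₁ + r₂) ∧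
    (List.range (q₁ + q₂ + 1)).map (tbSymbol (multIdeal n r)) =
      List.replicate q₁ r ++ List.replicate q₂ r₁ ++ [r₂] := by
  obtain ⟨rfl, rfl⟩ : n / r = q₁ ∧ n % r = r₁ :=
    (Nat.div_mod_unique (hr₁.trans hr₁r)).2 ⟨by rw [hn]; ring, hr₁r⟩
  obtain ⟨rfl, rfl⟩ : r / (n % r) = q₂ ∧ r % (n % r) = r₂ :=
    (Nat.div_mod_unique hr₁).2 ⟨by rw [mul_comm, add_comm, ← hr], hr₂⟩
  have hle (s : ℕ) (hs : s ≤ r / (n % r)) : s * (n % r) ≤ r :=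
    (Nat.mul_le_mul_right _ hs).trans (Nat.div_mul_le_self _ _)
  refine ⟨fun s hs => ?_, ?_, ?_⟩
  · rw [iterate_upperExtension_multIdeal, iterate_upperExtension_psiIdeal (hle s hs)]
  · rw [iterate_upperExtension_multIdeal, iterate_upperExtension_psiIdeal (hle _ le_rfl),
      upperExtension_extendedIdeal hr₁ hr₁r.le]
  · have hlast : (List.range 1).map
        (tbSymbol (extendedIdeal n r (n / r * r) (r / (n % r) * (n % r)))) = [r % (n % r)] :=
      congrArg (fun i => [i]) (criticalIndex_extendedIdeal hr₁)
    rw [map_tbSymbol_range_add, map_tbSymbol_range_add, criticalChain_add,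
      criticalChain_multIdeal, criticalChain_psiIdeal (hle _ le_rfl), map_tbSymbol_multIdeal,
      map_tbSymbol_psiIdeal (hle _ le_rfl), hlast]

theorem theorem3p14 (n r q₁ r₁ q₂ r₂ : ℕ) (hrn : r ≤ n)
    (hn : n = q₁ * r + r₁) (hr₁ : 0 < r₁) (hr₁r : r₁ < r)
    (hr : r = q₂ * r₁ + r₂) (hr₂ : r₂ < r₁) :
    (∀ s : ℕ, 1 ≤ s → s ≤ q₂ →
      (ThomBoardman.upperExtension r₁)^[s]
          ((ThomBoardman.upperExtension r)^[q₁] (ThomBoardman.multIdeal n r)) =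
        ThomBoardman.extendedIdeal n r (q₁ * r) (s * r₁)) ∧
    ThomBoardman.upperExtension r₂ ((ThomBoardman.upperExtension r₁)^[q₂]
          ((ThomBoardman.upperExtension r)^[q₁] (ThomBoardman.multIdeal n r))) =
        ThomBoardman.extendedIdeal n r (q₁ * r) (q₂ * r₁ + r₂) ∧
    (List.range (q₁ + q₂ + 1)).map (ThomBoardman.tbSymbol (ThomBoardman.multIdeal n r)) =
      List.replicate q₁ r ++ List.replicate q₂ r₁ ++ [r₂] :=
  have h := theorem3p14_general hn hr₁ hr₁r hr hr₂
  ⟨fun s _ hs => h.1 s hs, h.2⟩
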